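/- Let $T$ be a biperiodic edge-to-edge tiling of the Euclidean plane with convex regular polygons. That is, $T$ is a locally finite family of closed regular polygons (each with at least three sides) that cover the plane and have pairwise disjoint interiors; any two distinct tiles are disjoint, or meet exactly in a common corner, or meet exactly in a common side; and $T$ is invariant under the translations by some lattice of rank $2$ in the plane. The vertices and edges of the graph of $T$ are the corners and sides of the tiles. Suppose that every vertex of this graph has valence $3$ or $4$, and that the graph $T - V_4(T)$, obtained by deleting the set $V_4(T)$ of all $4$-valent vertices, admits a perfect matching, i.e. a pairing of adjacent vertices that includes every vertex exactly once. A vertex has type $a.b.c\ldots$ if an $a$-gon, a $b$-gon, a $c$-gon, etc. are the tiles around it in cyclic order (up to rotation and reversal). (i) If $T$ has only $4$-valent vertices, then every tile of $T$ is a triangle, a square or a hexagon, and every vertex of $T$ has one of the five types $3.3.6.6$, $3.6.3.6$, $3.4.4.6$, $3.4.6.4$, $4.4.4.4$. (ii) If $T$ has only $4$-valent vertices and $\Lambda$ is any rank $2$ lattice of translations that preserve $T$, then the number of triangles in a fundamental domain for $\Lambda$ (the number of $\Lambda$-orbits of triangular tiles) is finite and is twice the number of hexagons in it. (iii) If $T$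 has a $3$-valent vertex, then every tile of $T$ is a triangle, a square, a hexagon, an octagon or a dodecagon. -/

import Mathlib

/-! The Euclidean plane is `ℂ`. -/

namespace EuclideanTiling

/-- `P` is a (closed, convex) regular polygon with `n ≥ 3` sides: the convex hull of the points
`c + w * ζ ^ k`, `k = 0, …, n - 1`, where `ζ = exp (2πi / n)`, `c` is the centre and `w ≠ 0` is
the vector from the centre to one of the corners. -/
def IsRegularPolygon (n : ℕ) (P : Set ℂ) : Prop :=
  3 ≤ n ∧ ∃ c w : ℂ, w ≠ 0 ∧
    P = convexHull ℝ
      (Set.range fun k : Fin n => c + w * Complex.exp (2 * Real.pi * Complex.I / n) ^ (k : ℕ))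

/-- The corners (vertices) of a convex polygon. -/
def corners (P : Set ℂ) : Set ℂ := P.extremePoints ℝ

/-- `e` is a side of the convex polygon `P`: a closed segment that joins two distinct corners of `P`
and lies in the boundary of `P`. -/
def IsSide (e P : Set ℂ) : Prop :=
  ∃ a ∈ corners P, ∃ b ∈ corners P, a ≠ b ∧ e = segment ℝ a b ∧ e ⊆ frontier P

/-- The translate of a subset of the plane by the vector `t`. -/
def translateBy (t : ℂ) (P : Set ℂ) : Set ℂ := (fun z => t + z) '' P

end EuclideanTiling

open EuclideanTiling in
/-- A (locally finite) tiling of the Euclidean plane with convex regular polygons, possibly of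
different sizes and numbers of sides. -/
structure RegularPolygonTiling where
  /-- The tiles, as closed subsets of the plane. -/
  tiles : Set (Set ℂ)
  /-- Every tile is a regular polygon. -/
  regular : ∀ P ∈ tiles, ∃ n : ℕ, IsRegularPolygon n P
  /-- The tiles cover the plane. -/
  covers : ⋃₀ tiles = Set.univ
  /-- Distinct tiles do not overlap. -/
  nonoverlapping : ∀ P ∈ tiles, ∀ Q ∈ tiles, P ≠ Q → Disjoint (interior P) (interior Q)
  /-- Every point of the plane has a neighbourhood that meets only finitely many tiles. -/
  locallyFinite : LocallyFinite fun P : tiles => (P : Set ℂ)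

namespace RegularPolygonTiling

open EuclideanTiling

/-- A tiling is edge-to-edge if any two distinct tiles are disjoint, or meet exactly in a common
corner, or meet exactly in a common (entire) side. -/
def IsEdgeToEdge (T : RegularPolygonTiling) : Prop :=
  ∀ P ∈ T.tiles, ∀ Q ∈ T.tiles, P ≠ Q →
    P ∩ Q = ∅ ∨ (∃ v ∈ corners P ∩ corners Q, P ∩ Q = {v}) ∨
      (IsSide (P ∩ Q) P ∧ IsSide (P ∩ Q) Q)

/-- `Λ` is a lattice of translational symmetries of `T`, of full rank `2` in the plane. -/
structure IsPeriodLattice (T : RegularPolygonTiling) (Λ : Submodule ℤ ℂ) : Prop where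
  discrete : DiscreteTopology Λ
  isZLattice : IsZLattice ℝ Λ
  translate_mem : ∀ t ∈ Λ, ∀ P ∈ T.tiles, translateBy t P ∈ T.tiles

/-- A tiling is biperiodic if some lattice of rank `2` acts on it by translations. -/
def IsBiperiodic (T : RegularPolygonTiling) : Prop :=
  ∃ Λ : Submodule ℤ ℂ, T.IsPeriodLattice Λ

/-- The vertices of the tiling: the corners of its tiles. -/
def vertices (T : RegularPolygonTiling) : Set ℂ := {v | ∃ P ∈ T.tiles, v ∈ corners P}

/-- The graph of the tiling: its vertices, two of them being adjacent when they are joined by a side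
of a tile. -/
def graph (T : RegularPolygonTiling) : SimpleGraph T.vertices where
  Adj a b := a ≠ b ∧ ∃ P ∈ T.tiles, IsSide (segment ℝ (a : ℂ) (b : ℂ)) P
  symm := ⟨fun a b h => ⟨h.1.symm, by rw [segment_symm]; exact h.2⟩⟩
  loopless := ⟨fun _ h => h.1 rfl⟩

/-- The valence of a vertex of the tiling. -/
noncomputable def valence (T : RegularPolygonTiling) (v : T.vertices) : ℕ :=
  (T.graph.neighborSet v).ncard

/-- The set `V₄(T)` of the `4`-valent vertices. -/
def fourValent (T : RegularPolygonTiling) : Set T.vertices := {v | T.valence v = 4}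

/-- The graph `T - V₄(T)`, in which the `4`-valent vertices are deleted, admits a perfect
matching. -/
def HasMatching (T : RegularPolygonTiling) : Prop :=
  ∃ M : (T.graph.induce (T.fourValent)ᶜ).Subgraph, M.IsPerfectMatching

/-- The vertex `v` has type `a 0 . a 1 . ⋯ . a (k - 1)` (for `k ≥ 3`): the tiles at `v` can be listed
without repetition as `p 0, …, p (k - 1)`, cyclically, so that `p i` is an `a i`-gon and that `p i`
and its successor `p (i + 1)` (indices mod `k`) share a side at `v`. Types are hence considered up
to cyclic rotation and reversal. -/
def HasVertexType (T : RegularPolygonTiling) (v : T.vertices) {k : ℕ} [NeZero k]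
    (a : Fin k → ℕ) : Prop :=
  ∃ p : Fin k → Set ℂ, Function.Injective p ∧
    Set.range p = {P | P ∈ T.tiles ∧ (v : ℂ) ∈ P} ∧
    (∀ i, IsRegularPolygon (a i) (p i)) ∧
    ∀ i, ∃ e : Set ℂ, IsSide e (p i) ∧ IsSide e (p (i + 1)) ∧ (v : ℂ) ∈ e

/-- The `Λ`-orbits of the tiles of `T` with `n` sides. These are the `n`-gons of the quotient tiling
of the torus `ℂ / Λ`, so that their number is the number of `n`-gons in a fundamental domain
for `Λ`. -/
def polygonOrbits (T : RegularPolygonTiling) (Λ : Submodule ℤ ℂ) (n : ℕ) : Set (Set (Set ℂ)) :=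
  {O | ∃ P ∈ T.tiles, IsRegularPolygon n P ∧ O = {Q | ∃ t ∈ Λ, Q = translateBy t P}}

end RegularPolygonTiling

/-! Everything follows from the angles at a vertex and from the combinatorics of flags (a vertex, a
side at it, a tile with this side). The angle of a regular `n`-gon is `π - 2π/n`, and comparing
areas in a small disc shows that the angles around a vertex make a full turn (`sum_angles`). A
vertex lies in as many tiles as sides (`ncard_tilesAt`), so at valence `k` the reciprocals of the
sizes of the tiles add up to `(k - 2)/2` (`sum_inv_sides`).

At valence 4 this admits only the sizes 3, 4, 6, 12 (`four_unit_fractions`), at valence 3 only ten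
triples (`three_unit_fractions`). To go further, `FlagSystem` keeps of the tiling just three
involutions on the flags and the sizes; `Flag.three` and `Flag.four` supply the vertex equations. An
odd `n`-gon with `n ≠ 3` has only 3-valent vertices; the sizes across its sides alternate, hence are
all equal, which is impossible (`eq_three_of_odd`). The one unwanted triple left is then 3.8.24,
which would force a triangle with octagons across two sides (`size_mem_of_three_or_four`). If all
vertices are 4-valent, only the dodecagon has to be excluded: its vertices carry two triangles and a
square, and following the forced tiles leads to a vertex whose equation has no solution
(`size_mem_of_four`). The five types are what the equation permits with sizes 3, 4, 6.

For the count, `1/3` and `1/6` differ from `1/4` by `1/12` in opposite directions, so each vertex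
lies in as many triangles as hexagons (`card_three_eq_card_six`). Lattice translations act freely on
vertices and tiles; counting orbits of corners in two ways gives `3 N₃ = 6 N₆` for the numbers `N₃`,
`N₆` of orbits of triangles and hexagons. -/

namespace EuclideanTiling

/-! ### Sides, corners and overlaps of convex sets in the plane -/

/-- `x` is a neighbour of `v` in `P`: they are the two ends of a side of `P`. -/
def Nbr (P : Set ℂ) (v x : ℂ) : Prop :=
  v ∈ corners P ∧ x ∈ corners P ∧ v ≠ x ∧ segment ℝ v x ⊆ frontier P

lemma Nbr.symm {P : Set ℂ} {v x : ℂ} (h : Nbr P v x) : Nbr P x v :=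
  ⟨h.2.1, h.1, h.2.2.1.symm, by rw [segment_symm]; exact h.2.2.2⟩

lemma Nbr.isSide {P : Set ℂ} {v x : ℂ} (h : Nbr P v x) : IsSide (segment ℝ v x) P :=
  ⟨v, h.1, x, h.2.1, h.2.2.1, rfl, h.2.2.2⟩

lemma IsSide.exists_nbr {P e : Set ℂ} (h : IsSide e P) : ∃ v x, Nbr P v x ∧ e = segment ℝ v x := by
  obtain ⟨a, ha, b, hb, hab, rfl, hf⟩ := h
  exact ⟨a, b, ⟨ha, hb, hab, hf⟩, rfl⟩

lemma corners_subset (P : Set ℂ) : corners P ⊆ P := extremePoints_subset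

/-- A corner in a segment inside `P` is an end of it. -/
lemma corner_mem_segment {P : Set ℂ} {v a b : ℂ} (hv : v ∈ corners P) (ha : a ∈ P) (hb : b ∈ P)
    (h : v ∈ segment ℝ a b) : v = a ∨ v = b := by
  by_contra! hne
  have : v ∈ openSegment ℝ a b := mem_openSegment_of_ne_left_right hne.1.symm hne.2.symm h
  exact hne.1 ((mem_extremePoints.1 hv).2 a ha b hb this).1.symm

/-- A side is given as a mere set; its ends are recovered as the extreme points of this set. -/
lemma left_mem_corners_segment (a b : ℂ) : a ∈ corners (segment ℝ a b) := by
  rcases eq_or_ne a b with rfl | hab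
  · simp [corners]
  refine mem_extremePoints_iff_left.2 ⟨left_mem_segment _ _ _, ?_⟩
  rintro x hx y hy h
  rw [segment_eq_image_lineMap] at hx hy
  rw [openSegment_eq_image_lineMap] at h
  obtain ⟨s, hs, rfl⟩ := hx
  obtain ⟨t, ht, rfl⟩ := hy
  obtain ⟨r, hr, h⟩ := h
  simp only [AffineMap.lineMap_apply_module'] at h ⊢
  have h2 : ((1 - r) * s + r * t) • (b - a) = 0 := by
    simp only [Complex.real_smul] at h ⊢
    push_cast
    linear_combination h
  have h3 : (1 - r) * s + r * t = 0 := by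
    rcases smul_eq_zero.1 h2 with h | h
    · exact h
    · exact absurd (sub_eq_zero.1 h).symm hab
  have h4 : s = 0 := by
    by_contra hs0
    have : 0 < s := lt_of_le_of_ne hs.1 (Ne.symm hs0)
    nlinarith [mul_pos (sub_pos.2 hr.2) this, mul_nonneg hr.1.le ht.1]
  simp [h4]

lemma segment_eq_segment {a b c d : ℂ} (h : segment ℝ a b = segment ℝ c d) :
    (a = c ∧ b = d) ∨ (a = d ∧ b = c) := by
  have key : ∀ {a b c d : ℂ}, segment ℝ a b = segment ℝ c d → a = c ∨ a = d := by
    intro a b c d h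
    have ha := left_mem_corners_segment a b
    rw [h] at ha
    exact corner_mem_segment ha (left_mem_segment _ _ _) (right_mem_segment _ _ _)
      (corners_subset _ ha)
  have h1 := key h
  have h2 : b = c ∨ b = d := key (by rw [segment_symm, h])
  have h3 : c = a ∨ c = b := key h.symm
  have h4 : d = a ∨ d = b := key (by rw [segment_symm, h])
  grind

lemma nbr_of_isSide_segment {P : Set ℂ} {v x : ℂ} (h : IsSide (segment ℝ v x) P) : Nbr P v x := by
  obtain ⟨a, b, hab, he⟩ := h.exists_nbr
  rcases segment_eq_segment he with ⟨rfl, rfl⟩ | ⟨rfl, rfl⟩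
  · exact hab
  · exact hab.symm

/-- The cross product of two vectors of the plane. -/
def cross (z w : ℂ) : ℝ := z.re * w.im - z.im * w.re

lemma exists_real_mul_of_cross_eq_zero {z w : ℂ} (hz : z ≠ 0) (h : cross z w = 0) :
    ∃ r : ℝ, w = r * z := by
  unfold cross at h
  by_cases h1 : z.re = 0
  · have h2 : z.im ≠ 0 := fun h2 => hz (Complex.ext h1 h2)
    refine ⟨w.im / z.im, Complex.ext ?_ ?_⟩
    · simp [h1] at h ⊢; tauto
    · simp; field_simp
  · refine ⟨w.re / z.re, Complex.ext ?_ ?_⟩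
    · simp; field_simp
    · simp; field_simp; linarith

/-- No three corners are collinear. -/
lemma corners_not_collinear {P : Set ℂ} {a b c : ℂ} (ha : a ∈ corners P) (hb : b ∈ corners P)
    (hc : c ∈ corners P) (hab : a ≠ b) (h : cross (b - a) (c - a) = 0) : c = a ∨ c = b := by
  obtain ⟨r, hr⟩ := exists_real_mul_of_cross_eq_zero (sub_ne_zero.2 hab.symm) h
  have hcol : Collinear ℝ {a, b, c} := by
    rw [collinear_iff_of_mem (p₀ := a) (by simp)]
    refine ⟨b - a, ?_⟩
    simp only [Set.mem_insert_iff, Set.mem_singleton_iff, forall_eq_or_imp, forall_eq, vadd_eq_add,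
      Complex.real_smul]
    refine ⟨⟨0, by simp⟩, ⟨1, by simp⟩, ⟨r, by rw [← hr]; ring⟩⟩
  have hP := corners_subset P
  rcases hcol.wbtw_or_wbtw_or_wbtw with h | h | h
  all_goals
    rw [← mem_segment_iff_wbtw] at h
  · rcases corner_mem_segment hb (hP ha) (hP hc) h with h | h
    · exact absurd h.symm hab
    · exact Or.inr h.symm
  · exact (corner_mem_segment hc (hP hb) (hP ha) h).symm
  · rcases corner_mem_segment ha (hP hc) (hP hb) h with h | h
    · exact Or.inl h.symm
    · exact absurd h hab

/-- A convex body has a supporting line at each boundary point. -/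
lemma exists_support {P : Set ℂ} (hP : Convex ℝ P) (hi : (interior P).Nonempty) {m : ℂ}
    (hm : m ∈ frontier P) : ∃ p q : ℝ, (p ≠ 0 ∨ q ≠ 0) ∧
      ∀ z ∈ P, p * z.re + q * z.im ≤ p * m.re + q * m.im := by
  obtain ⟨f, hf⟩ := geometric_hahn_banach_open_point hP.interior isOpen_interior hm.2
  have hrep : ∀ z : ℂ, f z = f 1 * z.re + f Complex.I * z.im := by
    intro z
    have : z = z.re • (1 : ℂ) + z.im • Complex.I := by
      simp [Complex.re_add_im]
    conv_lhs => rw [this]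
    simp only [map_add, map_smul, smul_eq_mul]
    ring
  refine ⟨f 1, f Complex.I, ?_, ?_⟩
  · by_contra! h
    obtain ⟨z, hz⟩ := hi
    have := hf z hz
    rw [hrep z, hrep m, h.1, h.2] at this
    simp at this
  · intro z hz
    rw [← hrep, ← hrep]
    -- Hahn-Banach gives the inequality on the interior only; `P` lies in the closure of its
    -- interior.
    have hz' : z ∈ closure (interior P) := by
      rw [hP.closure_interior_eq_closure_of_nonempty_interior hi]
      exact subset_closure hz
    refine closure_minimal (s := interior P) (t := {z | f z ≤ f m}) ?_ ?_ hz'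
    · exact fun y hy => (hf y hy).le
    · exact isClosed_le f.continuous continuous_const

/-- Both ends of a segment through a supported point lie on the supporting line. -/
lemma support_ends {a b m : ℂ} {p q : ℝ} (hm : m ∈ openSegment ℝ a b)
    (ha : p * a.re + q * a.im ≤ p * m.re + q * m.im)
    (hb : p * b.re + q * b.im ≤ p * m.re + q * m.im) :
    p * a.re + q * a.im = p * m.re + q * m.im ∧ p * b.re + q * b.im = p * m.re + q * m.im := by
  obtain ⟨s, t, hs, ht, hst, rfl⟩ := hm
  simp only [Complex.add_re, Complex.real_smul, Complex.re_ofReal_mul, Complex.add_im,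
    Complex.im_ofReal_mul] at *
  obtain rfl : s = 1 - t := by linarith
  set A := p * a.re + q * a.im
  set B := p * b.re + q * b.im
  have e : p * ((1 - t) * a.re + t * b.re) + q * ((1 - t) * a.im + t * b.im) =
      (1 - t) * A + t * B := by ring
  rw [e] at *
  have h1 : A ≤ B := by nlinarith
  have h2 : B ≤ A := by nlinarith
  have : A = B := le_antisymm h1 h2
  rw [this]; constructor <;> ring

lemma cross_eq_zero_of_support {z w : ℂ} {p q : ℝ} (hpq : p ≠ 0 ∨ q ≠ 0)
    (hz : p * z.re + q * z.im = 0) (hw : p * w.re + q * w.im = 0) : cross z w = 0 := by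
  unfold cross
  rcases hpq with h | h
  · apply mul_left_cancel₀ h; linear_combination hz * w.im - z.im * hw
  · apply mul_left_cancel₀ h; linear_combination z.re * hw - hz * w.re

/-- Two sides of a convex polygon that share an inner point are equal. -/
lemma nbr_unique_of_mem {P : Set ℂ} (hP : Convex ℝ P) (hi : (interior P).Nonempty)
    {a b a' b' m : ℂ} (h : Nbr P a b) (h' : Nbr P a' b') (hm : m ∈ openSegment ℝ a b)
    (hm' : m ∈ segment ℝ a' b') : (a' = a ∧ b' = b) ∨ (a' = b ∧ b' = a) := by
  have hcP := corners_subset P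
  -- An inner point of one side is not a corner, hence is inner to the other side too. One
  -- supporting line at `m` then contains all four ends, and no three corners are collinear.
  have hmc : m ∉ corners P := by
    intro hc
    have := (mem_extremePoints.1 hc).2 a (hcP h.1) b (hcP h.2.1) hm
    exact h.2.2.1 (this.1.trans this.2.symm)
  have hm2 : m ∈ openSegment ℝ a' b' := by
    refine mem_openSegment_of_ne_left_right ?_ ?_ hm'
    · rintro rfl; exact hmc h'.1
    · rintro rfl; exact hmc h'.2.1
  obtain ⟨p, q, hpq, hs⟩ := exists_support hP hi (h.2.2.2 (openSegment_subset_segment _ _ _ hm))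
  obtain ⟨h1, h2⟩ := support_ends hm (hs a (hcP h.1)) (hs b (hcP h.2.1))
  obtain ⟨h3, h4⟩ := support_ends hm2 (hs a' (hcP h'.1)) (hs b' (hcP h'.2.1))
  have ka : a' = a ∨ a' = b := by
    refine corners_not_collinear h.1 h.2.1 h'.1 h.2.2.1 (cross_eq_zero_of_support hpq ?_ ?_)
    · simp; linarith
    · simp; linarith
  have kb : b' = a ∨ b' = b := by
    refine corners_not_collinear h.1 h.2.1 h'.2.1 h.2.2.1 (cross_eq_zero_of_support hpq ?_ ?_)
    · simp; linarith
    · simp; linarith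
  have := h'.2.2.1
  grind

/-- Convex bodies on the same side of a common segment overlap. -/
lemma overlap_of_cross_pos {P Q : Set ℂ} (hP : Convex ℝ P) (hQ : Convex ℝ Q) {a b p q : ℂ}
    (hab : a ≠ b) (haP : a ∈ P) (hbP : b ∈ P) (haQ : a ∈ Q) (hbQ : b ∈ Q) (hp : p ∈ interior P)
    (hq : q ∈ interior Q) (h : 0 < cross (b - a) (p - a) * cross (b - a) (q - a)) :
    (interior P ∩ interior Q).Nonempty := by
  set A := cross (b - a) (p - a) with hA
  set B := cross (b - a) (q - a) with hB
  have hB0 : B ≠ 0 := fun h0 => by simp [h0] at h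
  have hl : 0 < A / B := by
    rcases lt_or_gt_of_ne hB0 with h1 | h1
    · exact div_pos_of_neg_of_neg (by nlinarith) h1
    · exact div_pos (by nlinarith) h1
  set l := A / B with hlB
  set m : ℂ := (1 / 2 : ℝ) • a + (1 / 2 : ℝ) • b with hm
  -- Since `l` is the ratio of the distances of `p` and `q` from the line `ab`, the vectors `p - m`
  -- and `l * (q - m)` differ by a multiple of `b - a`. So a point close to the midpoint `m` in the
  -- direction of `p` is also a combination of `q` and a point of the segment `ab`.
  obtain ⟨r, hr⟩ : ∃ r : ℝ, (p - m) - l * (q - m) = r * (b - a) := by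
    apply exists_real_mul_of_cross_eq_zero (sub_ne_zero.2 hab.symm)
    have e1 : cross (b - a) (p - m) = A := by
      simp [hA, cross, hm]; ring
    have e2 : cross (b - a) (q - m) = B := by
      simp [hB, cross, hm]; ring
    have : cross (b - a) ((p - m) - l * (q - m)) =
        cross (b - a) (p - m) - l * cross (b - a) (q - m) := by
      simp [cross]; ring
    rw [this, e1, e2, hlB]; field_simp; ring
  -- These bounds give `|t| < (1/4) / (1/2)` below, which keeps the shifted midpoint in the segment
  -- `ab`.
  obtain ⟨ε, hε, h1, h2, h3⟩ : ∃ ε : ℝ, 0 < ε ∧ ε < 1 ∧ ε * l < 1 / 2 ∧ ε * |r| < 1 / 4 := by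
    refine ⟨1 / (2 + 2 * l + 4 * |r|), by positivity, ?_, ?_, ?_⟩
    · rw [div_lt_one (by positivity)]; nlinarith [abs_nonneg r]
    · rw [one_div_mul_eq_div, div_lt_div_iff₀ (by positivity) (by positivity)]
      nlinarith [abs_nonneg r]
    · rw [one_div_mul_eq_div, div_lt_div_iff₀ (by positivity) (by positivity)]
      nlinarith [abs_nonneg r]
  refine ⟨m + ε * (p - m), ?_, ?_⟩
  · have hmP : m ∈ closure P :=
      subset_closure (hP haP hbP (by norm_num) (by norm_num) (by norm_num))
    have := hP.combo_interior_closure_mem_interior hp hmP hε (sub_nonneg.2 h1.le) (by ring)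
    convert this using 1
    simp only [Complex.real_smul]; push_cast; ring
  · have hd : (0 : ℝ) < 1 - ε * l := by linarith
    set t : ℝ := ε * r / (1 - ε * l) with ht
    have ht2 : |t| < 1 / 2 := by
      rw [ht, abs_div, abs_mul, abs_of_pos hε, abs_of_pos hd, div_lt_iff₀ hd]; linarith
    obtain ⟨t1, t2⟩ := abs_lt.1 ht2
    have hmQ : (1 / 2 - t) • a + (1 / 2 + t) • b ∈ closure Q :=
      subset_closure (hQ haQ hbQ (by linarith) (by linarith) (by ring))
    have := hQ.combo_interior_closure_mem_interior hq hmQ (mul_pos hε hl) hd.le (by ring)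
    convert this using 1
    have hr' : p - m = l * (q - m) + r * (b - a) := by rw [← hr]; ring
    have ht' : ((1 - ε * l : ℝ) : ℂ) * (t : ℂ) = ε * r := by
      rw [← Complex.ofReal_mul, ht, mul_div_cancel₀ _ hd.ne']; push_cast; ring
    rw [hr']
    simp only [Complex.real_smul]
    push_cast at ht' ⊢
    have hm' : m = (1 / 2) * a + (1 / 2) * b := by rw [hm]; simp
    rw [hm']
    linear_combination (a - b) * ht'

/-- An open set is not contained in a line: a small step perpendicular to `b - a` changes the cross
product. -/
lemma exists_interior_cross_ne_zero {P : Set ℂ} (hi : (interior P).Nonempty) {a b : ℂ}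
    (hab : a ≠ b) : ∃ p ∈ interior P, cross (b - a) (p - a) ≠ 0 := by
  by_contra! hcon
  obtain ⟨p, hp⟩ := hi
  obtain ⟨ε, hε, hb⟩ := Metric.isOpen_iff.1 isOpen_interior p hp
  have hn : 0 < ‖b - a‖ := norm_pos_iff.2 (sub_ne_zero.2 hab.symm)
  set r : ℝ := ε / (2 * ‖b - a‖) with hr
  have hr0 : 0 < r := by positivity
  have h2 : p + r * (Complex.I * (b - a)) ∈ interior P := by
    apply hb
    rw [Metric.mem_ball, dist_eq_norm, add_sub_cancel_left, norm_mul, norm_mul, Complex.norm_real,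
      Complex.norm_I, one_mul, Real.norm_of_nonneg hr0.le, hr]
    field_simp; norm_num
  have e1 := hcon _ hp
  have e2 := hcon _ h2
  have e3 : cross (b - a) (p + r * (Complex.I * (b - a)) - a) = cross (b - a) (p - a) +
      r * ((b - a).re ^ 2 + (b - a).im ^ 2) := by
    simp [cross]; ring
  rw [e3, e1, zero_add] at e2
  have : (b - a).re ^ 2 + (b - a).im ^ 2 = ‖b - a‖ ^ 2 := by
    rw [← Complex.normSq_eq_norm_sq, Complex.normSq_apply]; ring
  rw [this] at e2
  have : 0 < r * ‖b - a‖ ^ 2 := by positivity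
  linarith

/-- At most two non-overlapping convex bodies share a segment. -/
lemma overlap_of_three {P Q R : Set ℂ} (hP : Convex ℝ P) (hQ : Convex ℝ Q) (hR : Convex ℝ R)
    (iP : (interior P).Nonempty) (iQ : (interior Q).Nonempty) (iR : (interior R).Nonempty)
    {a b : ℂ} (hab : a ≠ b) (haP : a ∈ P) (hbP : b ∈ P) (haQ : a ∈ Q) (hbQ : b ∈ Q)
    (haR : a ∈ R) (hbR : b ∈ R) :
    (interior P ∩ interior Q).Nonempty ∨ (interior P ∩ interior R).Nonempty ∨
      (interior Q ∩ interior R).Nonempty := by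
  obtain ⟨p, hp, hp0⟩ := exists_interior_cross_ne_zero iP hab
  obtain ⟨q, hq, hq0⟩ := exists_interior_cross_ne_zero iQ hab
  obtain ⟨r, hr, hr0⟩ := exists_interior_cross_ne_zero iR hab
  by_cases h1 : 0 < cross (b - a) (p - a) * cross (b - a) (q - a)
  · exact Or.inl (overlap_of_cross_pos hP hQ hab haP hbP haQ hbQ hp hq h1)
  by_cases h2 : 0 < cross (b - a) (p - a) * cross (b - a) (r - a)
  · exact Or.inr (Or.inl (overlap_of_cross_pos hP hR hab haP hbP haR hbR hp hr h2))
  -- The line has only two sides: if `q` and `r` are both opposite to `p`, they are on the same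
  -- side.
  refine Or.inr (Or.inr (overlap_of_cross_pos hQ hR hab haQ hbQ haR hbR hq hr ?_))
  rcases lt_or_gt_of_ne hp0 with hp1 | hp1 <;> rcases lt_or_gt_of_ne hq0 with hq1 | hq1 <;>
    rcases lt_or_gt_of_ne hr0 with hr1 | hr1 <;>
    first
    | exact mul_pos hq1 hr1
    | exact mul_pos_of_neg_of_neg hq1 hr1
    | exact absurd (mul_pos hp1 hq1) h1
    | exact absurd (mul_pos_of_neg_of_neg hp1 hq1) h1
    | exact absurd (mul_pos hp1 hr1) h2
    | exact absurd (mul_pos_of_neg_of_neg hp1 hr1) h2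

end EuclideanTiling

/-! ### Angles of convex sets and coordinates of regular polygons -/

namespace EuclideanTiling

/-- The convex set `P` has at `v` an angle `α`, spanned by the corners `a` and `b`. -/
structure IsWedge (P : Set ℂ) (v a b : ℂ) (α : ℝ) : Prop where
  convex : Convex ℝ P
  mem : v ∈ P
  left_mem : a ∈ P
  right_mem : b ∈ P
  ne : a - v ≠ 0
  angle_pos : 0 < α
  angle_lt : α < Real.pi
  right_eq : b - v = Complex.exp (α * Complex.I) * (a - v)
  cone : ∀ z ∈ P, ∃ s t : ℝ, 0 ≤ s ∧ 0 ≤ t ∧ z - v = s * (a - v) + t * (b - v)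

namespace IsWedge

variable {P : Set ℂ} {v a b : ℂ} {α : ℝ}

lemma sin_pos (h : IsWedge P v a b α) : 0 < Real.sin α :=
  Real.sin_pos_of_pos_of_lt_pi h.angle_pos h.angle_lt

lemma cross_pos (h : IsWedge P v a b α) : 0 < cross (a - v) (b - v) := by
  rw [h.right_eq]
  have : cross (a - v) (Complex.exp (α * Complex.I) * (a - v)) =
      Real.sin α * Complex.normSq (a - v) := by
    rw [Complex.exp_mul_I, ← Complex.ofReal_cos, ← Complex.ofReal_sin, Complex.normSq_apply]
    simp only [cross, Complex.mul_re, Complex.mul_im, Complex.add_re, Complex.add_im,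
      Complex.ofReal_re, Complex.ofReal_im, Complex.I_re, Complex.I_im]
    ring
  rw [this]
  exact mul_pos h.sin_pos (Complex.normSq_pos.2 h.ne)

lemma cross_comb (s t : ℝ) : cross (a - v) (s * (a - v) + t * (b - v)) =
    t * cross (a - v) (b - v) := by
  simp [cross]; ring

lemma cross_comb' (s t : ℝ) : cross (b - v) (s * (a - v) + t * (b - v)) =
    -(s * cross (a - v) (b - v)) := by
  simp [cross]; ring

lemma coeff_eq_zero (h : IsWedge P v a b α) {s t : ℝ} (hst : s * (a - v) + t * (b - v) = 0) :
    s = 0 ∧ t = 0 := by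
  have h1 := cross_comb (v := v) (a := a) (b := b) s t
  have h2 := cross_comb' (v := v) (a := a) (b := b) s t
  rw [hst] at h1 h2
  have hc := h.cross_pos.ne'
  simp only [cross, Complex.zero_re, Complex.zero_im, mul_zero, sub_zero] at h1 h2
  exact ⟨by simpa [cross, hc] using neg_eq_zero.1 h2.symm |> mul_eq_zero.1 |>.resolve_right hc,
    (mul_eq_zero.1 h1.symm).resolve_right hc⟩

/-- A cone spanned by two independent directions is pointed: `0` is a proper convex combination of
two of its elements only if both vanish. -/
lemma corner (h : IsWedge P v a b α) : v ∈ corners P := by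
  refine mem_extremePoints_iff_left.2 ⟨h.mem, ?_⟩
  rintro x hx y hy ⟨p, q, hp, hq, hpq, he⟩
  obtain ⟨s, t, hs, ht, h1⟩ := h.cone x hx
  obtain ⟨s', t', hs', ht', h2⟩ := h.cone y hy
  have hpq' : (p : ℂ) + q = 1 := by exact_mod_cast hpq
  simp only [Complex.real_smul] at he
  have h3 : ((p * s + q * s' : ℝ) : ℂ) * (a - v) + ((p * t + q * t' : ℝ) : ℂ) * (b - v) = 0 := by
    push_cast
    linear_combination he - p * h1 - q * h2 - hpq' * v
  obtain ⟨h4, h5⟩ := h.coeff_eq_zero h3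
  have hs0 : s = 0 := by
    have h6 := mul_nonneg hp.le hs
    have h7 := mul_nonneg hq.le hs'
    have : p * s = 0 := by linarith
    exact (mul_eq_zero.1 this).resolve_left hp.ne'
  have ht0 : t = 0 := by
    have h6 := mul_nonneg hp.le ht
    have h7 := mul_nonneg hq.le ht'
    have : p * t = 0 := by linarith
    exact (mul_eq_zero.1 this).resolve_left hp.ne'
  rw [hs0, ht0] at h1
  simpa [sub_eq_zero] using h1

/-- `P` lies on one side of the line through `v` and `a`, and from a point of this line a small step
along `-(b - v)` leads to the other side. -/
lemma not_mem_interior (h : IsWedge P v a b α) (m : ℂ) (hm : cross (a - v) (m - v) = 0) :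
    m ∉ interior P := by
  intro hi
  have hcont : Continuous fun ε : ℝ => m - ε * (b - v) := by fun_prop
  have : ∀ᶠ ε : ℝ in nhds 0, m - ε * (b - v) ∈ interior P :=
    hcont.continuousAt.eventually_mem (isOpen_interior.mem_nhds (by simpa using hi))
  obtain ⟨ε, hε, hε0⟩ := ((this.filter_mono nhdsWithin_le_nhds).and
    (self_mem_nhdsWithin (s := Set.Ioi (0 : ℝ)))).exists
  obtain ⟨s, t, hs, ht, h1⟩ := h.cone _ (interior_subset hε)
  have h2 := cross_comb (v := v) (a := a) (b := b) s t
  rw [← h1] at h2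
  have h3 : cross (a - v) (m - ε * (b - v) - v) =
      cross (a - v) (m - v) - ε * cross (a - v) (b - v) := by
    simp [cross]; ring
  rw [h3, hm] at h2
  have := h.cross_pos
  have h4 : 0 < ε * cross (a - v) (b - v) := mul_pos hε0 this
  have h5 : 0 ≤ t * cross (a - v) (b - v) := mul_nonneg ht this.le
  linarith

lemma not_mem_interior' (h : IsWedge P v a b α) (m : ℂ) (hm : cross (b - v) (m - v) = 0) :
    m ∉ interior P := by
  intro hi
  have hcont : Continuous fun ε : ℝ => m - ε * (a - v) := by fun_prop
  have : ∀ᶠ ε : ℝ in nhds 0, m - ε * (a - v) ∈ interior P :=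
    hcont.continuousAt.eventually_mem (isOpen_interior.mem_nhds (by simpa using hi))
  obtain ⟨ε, hε, hε0⟩ := ((this.filter_mono nhdsWithin_le_nhds).and
    (self_mem_nhdsWithin (s := Set.Ioi (0 : ℝ)))).exists
  obtain ⟨s, t, hs, ht, h1⟩ := h.cone _ (interior_subset hε)
  have h2 := cross_comb' (v := v) (a := a) (b := b) s t
  rw [← h1] at h2
  have h3 : cross (b - v) (m - ε * (a - v) - v) =
      cross (b - v) (m - v) + ε * cross (a - v) (b - v) := by
    simp [cross]; ring
  rw [h3, hm] at h2
  have := h.cross_pos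
  have h4 : 0 < ε * cross (a - v) (b - v) := mul_pos hε0 this
  have h5 : 0 ≤ s * cross (a - v) (b - v) := mul_nonneg hs this.le
  linarith

lemma cross_segment {x m : ℂ} (hm : m ∈ segment ℝ v x) : cross (x - v) (m - v) = 0 := by
  obtain ⟨p, q, hp, hq, hpq, rfl⟩ := hm
  obtain rfl : p = 1 - q := by linarith
  simp [cross]; ring

lemma nbr_left (h : IsWedge P v a b α) (ha : a ∈ corners P) : Nbr P v a := by
  refine ⟨h.corner, ha, fun e => h.ne (by rw [e, sub_self]), fun m hm => ⟨?_, ?_⟩⟩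
  · exact subset_closure (h.convex.segment_subset h.mem h.left_mem hm)
  · exact h.not_mem_interior m (cross_segment hm)

lemma nbr_right (h : IsWedge P v a b α) (hb : b ∈ corners P) : Nbr P v b := by
  refine ⟨h.corner, hb, fun e => ?_, fun m hm => ⟨?_, ?_⟩⟩
  · have := h.cross_pos
    rw [← e] at this
    simp [cross] at this
  · exact subset_closure (h.convex.segment_subset h.mem h.right_mem hm)
  · exact h.not_mem_interior' m (cross_segment hm)

/-- A supporting line at the midpoint of `[v, x]` contains `v` and `x`. Its functional is
nonpositive on `a - v` and `b - v` but vanishes on their nonnegative combination `x - v`, so each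
term vanishes. This puts `x` on the line of one of the two sides. -/
lemma eq_of_nbr (h : IsWedge P v a b α) (hi : (interior P).Nonempty) (ha : a ∈ corners P)
    (hb : b ∈ corners P) {x : ℂ} (hx : Nbr P v x) : x = a ∨ x = b := by
  set m : ℂ := (1 / 2 : ℝ) • v + (1 / 2 : ℝ) • x with hm
  have hmo : m ∈ openSegment ℝ v x := ⟨1 / 2, 1 / 2, by norm_num, by norm_num, by norm_num, rfl⟩
  obtain ⟨p, q, hpq, hs⟩ :=
    exists_support h.convex hi (hx.2.2.2 (openSegment_subset_segment _ _ _ hmo))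
  have hxP := corners_subset P hx.2.1
  obtain ⟨e1, e2⟩ := support_ends hmo (hs v h.mem) (hs x hxP)
  rw [← e1] at e2 hs
  obtain ⟨s, t, hs0, ht0, hc⟩ := h.cone x hxP
  have fa := hs a h.left_mem
  have fb := hs b h.right_mem
  have r1 := congrArg Complex.re hc
  have r2 := congrArg Complex.im hc
  simp only [Complex.sub_re, Complex.add_re, Complex.re_ofReal_mul, Complex.sub_im, Complex.add_im,
    Complex.im_ofReal_mul] at r1 r2
  have hsum : s * (p * (a.re - v.re) + q * (a.im - v.im)) +
      t * (p * (b.re - v.re) + q * (b.im - v.im)) = 0 := by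
    linear_combination e2 - p * r1 - q * r2
  have k1 : s * (p * (a.re - v.re) + q * (a.im - v.im)) ≤ 0 :=
    mul_nonpos_of_nonneg_of_nonpos hs0 (by linarith)
  have k2 : t * (p * (b.re - v.re) + q * (b.im - v.im)) ≤ 0 :=
    mul_nonpos_of_nonneg_of_nonpos ht0 (by linarith)
  have z1 := mul_eq_zero.1 (le_antisymm k1 (by linarith))
  have z2 := mul_eq_zero.1 (le_antisymm k2 (by linarith))
  have hne : ∀ y, y ∈ corners P → y ≠ v → cross (y - v) (x - v) = 0 → x = y := by
    intro y hy hyv hcr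
    rcases corners_not_collinear h.corner hy hx.2.1 hyv.symm hcr with h1 | h1
    · exact absurd h1.symm hx.2.2.1
    · exact h1
  rcases z1 with z1 | z1
  · right
    refine hne b hb (h.nbr_right hb).2.2.1.symm ?_
    rw [hc, z1]; simp [cross]; ring
  rcases z2 with z2 | z2
  · left
    refine hne a ha (h.nbr_left ha).2.2.1.symm ?_
    rw [hc, z2]; simp [cross]; ring
  · have : cross (a - v) (b - v) = 0 := cross_eq_zero_of_support hpq (by simpa using z1)
      (by simpa using z2)
    exact absurd this h.cross_pos.ne'

end IsWedge

/-- The `k`-th corner of the regular `n`-gon with centre `c` and zeroth corner `c + w`. -/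
noncomputable def ngonCorner (n : ℕ) (c w : ℂ) (k : ℤ) : ℂ :=
  c + w * Complex.exp (2 * Real.pi * Complex.I / n) ^ k

lemma ngonCorner_add (n : ℕ) (c w : ℂ) (j k : ℤ) :
    ngonCorner n c w (j + k) =
      ngonCorner n c (w * Complex.exp (2 * Real.pi * Complex.I / n) ^ j) k := by
  simp only [ngonCorner, zpow_add₀ (Complex.exp_ne_zero _)]; ring

lemma ngonCorner_eq_iff {n : ℕ} (hn : n ≠ 0) {c w : ℂ} (hw : w ≠ 0) (j k : ℤ) :
    ngonCorner n c w j = ngonCorner n c w k ↔ (n : ℤ) ∣ j - k := by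
  have hζ := Complex.isPrimitiveRoot_exp n hn
  rw [← hζ.zpow_eq_one_iff_dvd, zpow_sub₀ (Complex.exp_ne_zero _),
    div_eq_one_iff_eq (zpow_ne_zero _ (Complex.exp_ne_zero _))]
  simp [ngonCorner, hw]

lemma range_ngonCorner {n : ℕ} (hn : n ≠ 0) (c w : ℂ) :
    (Set.range fun k : Fin n => c + w * Complex.exp (2 * Real.pi * Complex.I / n) ^ (k : ℕ)) =
      Set.range (ngonCorner n c w) := by
  ext z
  constructor
  · rintro ⟨k, rfl⟩
    exact ⟨k, by simp [ngonCorner]⟩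
  · rintro ⟨k, rfl⟩
    have h0 : (0 : ℤ) < n := by positivity
    have h1 := Int.emod_nonneg k h0.ne'
    have h2 := Int.emod_lt_of_pos k h0
    refine ⟨⟨(k % n).toNat, by lia⟩, ?_⟩
    have hζ := (Complex.isPrimitiveRoot_exp n hn).zpow_eq_one
    simp only [ngonCorner]
    rw [← zpow_natCast, Int.toNat_of_nonneg h1]
    congr 2
    conv_rhs => rw [← Int.emod_add_mul_ediv k n, zpow_add₀ (Complex.exp_ne_zero _), zpow_mul,
      zpow_natCast, (Complex.isPrimitiveRoot_exp n hn).pow_eq_one, one_zpow, mul_one]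

lemma range_ngonCorner_shift (n : ℕ) (c w : ℂ) (k : ℤ) :
    Set.range (ngonCorner n c (w * Complex.exp (2 * Real.pi * Complex.I / n) ^ k)) =
      Set.range (ngonCorner n c w) := by
  ext z
  constructor
  · rintro ⟨j, rfl⟩
    exact ⟨k + j, ngonCorner_add ..⟩
  · rintro ⟨j, rfl⟩
    exact ⟨j - k, by simp [← ngonCorner_add]⟩

/-- The directions from a corner to the other corners are combinations of the directions to the two
next corners. -/
lemma exists_ngon_cone {n : ℕ} (hn : 3 ≤ n) (j : ℕ) (hj : j < n) : ∃ s t : ℝ, 0 ≤ s ∧ 0 ≤ t ∧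
    Complex.exp (2 * Real.pi * Complex.I / n) ^ j - 1 =
      s * (Complex.exp (2 * Real.pi * Complex.I / n) - 1) +
      t * ((Complex.exp (2 * Real.pi * Complex.I / n))⁻¹ - 1) := by
  rcases Nat.eq_zero_or_pos j with rfl | hj0
  · exact ⟨0, 0, le_rfl, le_rfl, by simp⟩
  set θ : ℝ := Real.pi / n with hθ
  have hn0 : (0 : ℝ) < n := by positivity
  have hpi := Real.pi_pos
  have hθ0 : 0 < θ := by positivity
  have hn3 : (3 : ℝ) ≤ n := by exact_mod_cast hn
  have hθ1 : θ < Real.pi / 2 := by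
    rw [hθ, div_lt_div_iff₀ hn0 two_pos]; nlinarith
  have hs0 : 0 < Real.sin θ := Real.sin_pos_of_pos_of_lt_pi hθ0 (by linarith)
  have hc0 : 0 < Real.cos θ := Real.cos_pos_of_mem_Ioo ⟨by linarith, hθ1⟩
  have hmul : ∀ k : ℕ, k ≤ n → 0 ≤ Real.sin (k * θ) := by
    intro k hk
    refine Real.sin_nonneg_of_nonneg_of_le_pi (by positivity) ?_
    rw [hθ, mul_div_assoc', div_le_iff₀ hn0, mul_comm]
    have : (k : ℝ) ≤ n := by exact_mod_cast hk
    nlinarith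
  have h1 := hmul j hj.le
  have h2 := hmul (j + 1) hj
  have h3 := hmul (j - 1) (by lia)
  rw [Nat.cast_sub hj0] at h3
  push_cast at h2 h3
  set S := Real.sin (j * θ) with hS
  set C := Real.cos (j * θ) with hC
  have hplus : Real.sin ((j + 1) * θ) = S * Real.cos θ + C * Real.sin θ := by
    rw [add_mul, one_mul, Real.sin_add]
  have hminus : Real.sin ((j - 1) * θ) = S * Real.cos θ - C * Real.sin θ := by
    rw [sub_mul, one_mul, Real.sin_sub]
  rw [hplus] at h2
  rw [hminus] at h3
  have hexp : ∀ k : ℕ, Complex.exp (2 * Real.pi * Complex.I / n) ^ k =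
      ((1 - 2 * Real.sin (k * θ) ^ 2 : ℝ) : ℂ) +
        ((2 * Real.sin (k * θ) * Real.cos (k * θ) : ℝ) : ℂ) * Complex.I := by
    intro k
    have e : 1 - 2 * Real.sin (k * θ) ^ 2 = Real.cos (2 * (k * θ)) := by
      rw [Real.cos_two_mul, Real.cos_sq']; ring
    rw [e, ← Real.sin_two_mul, Complex.ofReal_cos, Complex.ofReal_sin, ← Complex.exp_mul_I,
      ← Complex.exp_nat_mul, hθ]
    congr 1
    push_cast
    ring
  have hinv : (Complex.exp (2 * Real.pi * Complex.I / n))⁻¹ =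
      ((1 - 2 * Real.sin θ ^ 2 : ℝ) : ℂ) -
        ((2 * Real.sin θ * Real.cos θ : ℝ) : ℂ) * Complex.I := by
    have e : 1 - 2 * Real.sin θ ^ 2 = Real.cos (2 * θ) := by
      rw [Real.cos_two_mul, Real.cos_sq']; ring
    rw [e, ← Real.sin_two_mul, Complex.ofReal_cos, Complex.ofReal_sin, ← Complex.exp_neg]
    rw [← Complex.cos_neg, sub_eq_add_neg, ← neg_mul, ← Complex.sin_neg, ← Complex.exp_mul_I, hθ]
    congr 1
    push_cast
    ring
  have h1' := hexp 1
  simp only [pow_one, Nat.cast_one, one_mul] at h1'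
  -- The solution of the linear system for `s` and `t`, with `θ = π/n`. The numerators are `sin (jθ)
  -- sin ((j ± 1)θ)`, nonnegative as `0 ≤ j - 1` and `j + 1 ≤ n`.
  refine ⟨S * (S * Real.cos θ + C * Real.sin θ) / (2 * Real.sin θ ^ 2 * Real.cos θ),
    S * (S * Real.cos θ - C * Real.sin θ) / (2 * Real.sin θ ^ 2 * Real.cos θ), by positivity,
    by positivity, ?_⟩
  rw [hinv, hexp j, h1', ← hS, ← hC]
  clear_value S C
  clear hexp hinv h1' hplus hminus hS hC h1 h2 h3
  generalize Real.sin θ = x at *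
  generalize Real.cos θ = y at *
  simp only [Complex.ext_iff, Complex.add_re, Complex.add_im, Complex.sub_re, Complex.sub_im,
    Complex.re_ofReal_mul, Complex.im_ofReal_mul, Complex.ofReal_re, Complex.ofReal_im,
    Complex.I_re, Complex.I_im, Complex.one_re, Complex.one_im]
  constructor <;> field_simp <;> ring

/-- The angle comes from `ζ⁻¹ - 1 = -ζ⁻¹ (ζ - 1)`. The cone condition is convex, so it only has to
be checked at the corners, where it is `exists_ngon_cone`. -/
lemma isWedge_ngon {n : ℕ} (hn : 3 ≤ n) {c w : ℂ} (hw : w ≠ 0) :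
    IsWedge (convexHull ℝ (Set.range (ngonCorner n c w))) (ngonCorner n c w 0)
      (ngonCorner n c w 1) (ngonCorner n c w (-1)) (Real.pi - 2 * Real.pi / n) := by
  have hn0 : (0 : ℝ) < n := by positivity
  have hpi := Real.pi_pos
  have hn3 : (3 : ℝ) ≤ n := by exact_mod_cast hn
  have hsub : Set.range (ngonCorner n c w) ⊆ convexHull ℝ (Set.range (ngonCorner n c w)) :=
    subset_convexHull ℝ _
  have hne : ngonCorner n c w 1 ≠ ngonCorner n c w 0 := by
    rw [Ne, ngonCorner_eq_iff (by lia) hw]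
    intro h
    have := Int.le_of_dvd (by norm_num) h
    lia
  refine ⟨convex_convexHull ℝ _, hsub ⟨0, rfl⟩, hsub ⟨1, rfl⟩, hsub ⟨-1, rfl⟩, sub_ne_zero.2 hne,
    ?_, ?_, ?_, ?_⟩
  · rw [sub_pos, div_lt_iff₀ hn0]; nlinarith
  · have : 0 < 2 * Real.pi / n := by positivity
    linarith
  · have e : Complex.exp ((Real.pi - 2 * Real.pi / n : ℝ) * Complex.I) =
        -(Complex.exp (2 * Real.pi * Complex.I / n))⁻¹ := by
      push_cast
      rw [sub_mul, Complex.exp_sub, Complex.exp_pi_mul_I, neg_div, one_div]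
      congr 3
      ring
    rw [e]
    have := Complex.exp_ne_zero (2 * Real.pi * Complex.I / n)
    simp only [ngonCorner, zpow_zero, zpow_one, zpow_neg]
    field_simp
    ring
  · intro z hz
    set p := ngonCorner n c w with hp
    have hconv : Convex ℝ {z : ℂ | ∃ s t : ℝ, 0 ≤ s ∧ 0 ≤ t ∧
        z - p 0 = s * (p 1 - p 0) + t * (p (-1) - p 0)} := by
      rintro x ⟨s, t, hs, ht, hx⟩ y ⟨s', t', hs', ht', hy⟩ k l hk hl hkl
      refine ⟨k * s + l * s', k * t + l * t', by positivity, by positivity, ?_⟩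
      have hkl' : (k : ℂ) + l = 1 := by exact_mod_cast hkl
      simp only [Complex.real_smul]
      push_cast
      linear_combination k * hx + l * hy + hkl' * p 0
    refine convexHull_min ?_ hconv hz
    rw [hp, ← range_ngonCorner (by lia)]
    rintro _ ⟨j, rfl⟩
    obtain ⟨s, t, hs, ht, h⟩ := exists_ngon_cone hn j j.2
    refine ⟨s, t, hs, ht, ?_⟩
    simp only [ngonCorner, zpow_zero, zpow_one, zpow_neg]
    linear_combination w * h

lemma isWedge_ngon_shift {n : ℕ} (hn : 3 ≤ n) {c w : ℂ} (hw : w ≠ 0) (k : ℤ) :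
    IsWedge (convexHull ℝ (Set.range (ngonCorner n c w))) (ngonCorner n c w k)
      (ngonCorner n c w (k + 1)) (ngonCorner n c w (k - 1)) (Real.pi - 2 * Real.pi / n) := by
  have := isWedge_ngon hn (c := c)
    (mul_ne_zero hw (zpow_ne_zero k (Complex.exp_ne_zero (2 * Real.pi * Complex.I / n))))
  rw [range_ngonCorner_shift] at this
  simpa only [← ngonCorner_add, add_zero, ← sub_eq_add_neg] using this

lemma corners_ngon {n : ℕ} (hn : 3 ≤ n) {c w : ℂ} (hw : w ≠ 0) :
    corners (convexHull ℝ (Set.range (ngonCorner n c w))) = Set.range (ngonCorner n c w) := by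
  refine Set.Subset.antisymm extremePoints_convexHull_subset ?_
  rintro _ ⟨k, rfl⟩
  exact (isWedge_ngon_shift hn hw k).corner

lemma IsRegularPolygon.exists_eq {n : ℕ} {P : Set ℂ} (h : IsRegularPolygon n P) :
    ∃ c w : ℂ, w ≠ 0 ∧ P = convexHull ℝ (Set.range (ngonCorner n c w)) := by
  obtain ⟨hn, c, w, hw, rfl⟩ := h
  exact ⟨c, w, hw, by rw [range_ngonCorner (by lia)]⟩

lemma IsRegularPolygon.convex {n : ℕ} {P : Set ℂ} (h : IsRegularPolygon n P) : Convex ℝ P := by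
  obtain ⟨c, w, hw, rfl⟩ := h.exists_eq
  exact convex_convexHull ℝ _

lemma IsRegularPolygon.isCompact {n : ℕ} {P : Set ℂ} (h : IsRegularPolygon n P) : IsCompact P := by
  obtain ⟨hn, c, w, hw, rfl⟩ := h
  exact (Set.finite_range _).isCompact_convexHull (𝕜 := ℝ)

lemma IsRegularPolygon.ncard_corners {n : ℕ} {P : Set ℂ} (h : IsRegularPolygon n P) :
    (corners P).ncard = n := by
  have hn := h.1
  obtain ⟨c, w, hw, rfl⟩ := h.exists_eq
  rw [corners_ngon hn hw, ← range_ngonCorner (by lia), ← Set.image_univ, Set.ncard_image_of_injective,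
    Set.ncard_univ, Nat.card_eq_fintype_card, Fintype.card_fin]
  intro j k hjk
  have h1 : ngonCorner n c w (j : ℕ) = ngonCorner n c w (k : ℕ) := by
    simpa [ngonCorner] using hjk
  rw [ngonCorner_eq_iff (by lia) hw] at h1
  have := Int.eq_zero_of_abs_lt_dvd h1 (by rw [abs_lt]; constructor <;> lia)
  exact Fin.ext (by lia)

lemma IsRegularPolygon.unique {m n : ℕ} {P : Set ℂ} (h : IsRegularPolygon m P)
    (h' : IsRegularPolygon n P) : m = n := by
  rw [← h.ncard_corners, h'.ncard_corners]

end EuclideanTiling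

/-! ### Areas of sectors and the angle sum at a point -/

namespace EuclideanTiling

open MeasureTheory

/-- The closed sector of the directions from `0` to `α`. -/
def sector (α : ℝ) : Set ℂ := {z | 0 ≤ z.im ∧ (z * Complex.exp (-(α * Complex.I))).im ≤ 0}

lemma measurableSet_sector (α : ℝ) : MeasurableSet (sector α) := by
  refine (IsClosed.inter (s₁ := {z : ℂ | 0 ≤ z.im})
    (s₂ := {z : ℂ | (z * Complex.exp (-(α * Complex.I))).im ≤ 0}) ?_ ?_).measurableSet
  · exact isClosed_le continuous_const Complex.continuous_im
  · exact isClosed_le (by fun_prop) continuous_const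

lemma smul_mem_sector {α : ℝ} {r : ℝ} (hr : 0 < r) {z : ℂ} :
    (r : ℂ) * z ∈ sector α ↔ z ∈ sector α := by
  simp only [sector, Set.mem_ofPred_eq, mul_assoc, Complex.im_ofReal_mul, mul_nonneg_iff_of_pos_left hr]
  rw [mul_nonpos_iff_pos_imp_nonpos]
  simp only [hr, hr.le, forall_const, implies_true, and_true]

/-- Membership is decided by the signs of `sin θ` and `sin (θ - α)`; once `0 ≤ θ`, both arguments
are within `(-π, π)`, where the sine has the sign of its argument. -/
lemma polar_mem_sector {α ρ θ : ℝ} (h0 : 0 < α) (hα : α < Real.pi) (hρ : 0 < ρ)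
    (hθ : θ ∈ Set.Ioo (-Real.pi) Real.pi) :
    (ρ : ℂ) * Complex.exp (θ * Complex.I) ∈ sector α ↔ θ ∈ Set.Icc 0 α := by
  rw [smul_mem_sector hρ, sector, Set.mem_ofPred_eq, ← Complex.exp_add,
    show (θ : ℂ) * Complex.I + -(α * Complex.I) = ((θ - α : ℝ) : ℂ) * Complex.I by push_cast; ring,
    Complex.exp_ofReal_mul_I_im, Complex.exp_ofReal_mul_I_im]
  obtain ⟨h1, h2⟩ := hθ
  have h3 : 0 ≤ Real.sin θ ↔ 0 ≤ θ := by
    constructor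
    · intro h
      by_contra! h4
      exact absurd (Real.sin_neg_of_neg_of_neg_pi_lt h4 h1) (not_lt.2 h)
    · exact fun h => Real.sin_nonneg_of_nonneg_of_le_pi h h2.le
  rw [h3]
  refine and_congr_right fun hθ0 => ?_
  constructor
  · intro h
    by_contra! h4
    exact absurd (Real.sin_pos_of_pos_of_lt_pi (by linarith) (by linarith)) (not_lt.2 h)
  · exact fun h => Real.sin_nonpos_of_nonpos_of_neg_pi_le (by linarith) (by linarith)

/-- The area of a circular sector. -/
lemma volume_sector_inter_ball {α r : ℝ} (h0 : 0 < α) (hα : α < Real.pi) (hr : 0 < r) :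
    volume (sector α ∩ Metric.ball 0 r) = ENNReal.ofReal (α * (r ^ 2 / 2)) := by
  have hm : MeasurableSet (sector α ∩ Metric.ball (0 : ℂ) r) :=
    (measurableSet_sector α).inter measurableSet_ball
  rw [← lintegral_indicator_one hm, ← Complex.lintegral_comp_polarCoord_symm]
  have hsub : Set.Ioo 0 r ×ˢ Set.Icc 0 α ⊆ polarCoord.target := by
    rintro ⟨ρ, θ⟩ ⟨h1, h2⟩
    rw [polarCoord_target]
    exact ⟨h1.1, by constructor <;> linarith [h2.1, h2.2]⟩
  have hcongr : ∀ p ∈ polarCoord.target, ENNReal.ofReal p.1 •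
      (sector α ∩ Metric.ball (0 : ℂ) r).indicator (1 : ℂ → ENNReal) (Complex.polarCoord.symm p) =
      (Set.Ioo 0 r ×ˢ Set.Icc 0 α).indicator (fun p : ℝ × ℝ => ENNReal.ofReal p.1) p := by
    rintro ⟨ρ, θ⟩ hp
    rw [polarCoord_target] at hp
    obtain ⟨hρ, hθ⟩ := hp
    have hρ' : 0 < ρ := hρ
    have e : Complex.polarCoord.symm (ρ, θ) = (ρ : ℂ) * Complex.exp (θ * Complex.I) := by
      rw [Complex.polarCoord_symm_apply, Complex.exp_mul_I]
      push_cast; rfl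
    have hiff : Complex.polarCoord.symm (ρ, θ) ∈ sector α ∩ Metric.ball (0 : ℂ) r ↔
        (ρ, θ) ∈ Set.Ioo 0 r ×ˢ Set.Icc 0 α := by
      rw [e, Set.mem_inter_iff, polar_mem_sector h0 hα hρ' hθ, mem_ball_zero_iff, norm_mul,
        Complex.norm_exp_ofReal_mul_I, mul_one, Complex.norm_real, Real.norm_of_nonneg hρ'.le,
        Set.mem_prod, Set.mem_Ioo]
      tauto
    by_cases h : (ρ, θ) ∈ Set.Ioo 0 r ×ˢ Set.Icc 0 α
    · rw [Set.indicator_of_mem h, Set.indicator_of_mem (hiff.2 h)]; simp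
    · rw [Set.indicator_of_notMem h, Set.indicator_of_notMem (fun h' => h (hiff.1 h'))]; simp
  rw [setLIntegral_congr_fun polarCoord.open_target.measurableSet hcongr,
    setLIntegral_indicator (measurableSet_Ioo.prod measurableSet_Icc),
    Set.inter_eq_left.2 hsub, Measure.volume_eq_prod, ← Measure.prod_restrict,
    lintegral_prod _ (by fun_prop)]
  simp only [lintegral_const, Measure.restrict_apply_univ, Real.volume_Icc, sub_zero]
  rw [lintegral_mul_const _ (by fun_prop), ← ofReal_integral_eq_lintegral_ofReal, mul_comm α,
    ENNReal.ofReal_mul (by positivity), ← integral_Ioc_eq_integral_Ioo,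
    ← intervalIntegral.integral_of_le hr.le, integral_id]
  · simp
  · exact (continuous_id.integrableOn_Icc (a := 0) (b := r)).mono_set Set.Ioo_subset_Icc_self
  · exact (ae_restrict_iff' measurableSet_Ioo).2 (Filter.Eventually.of_forall fun x hx => hx.1.le)

namespace IsWedge

variable {P : Set ℂ} {v a b : ℂ} {α : ℝ}

lemma mem_sector (h : IsWedge P v a b α) {z : ℂ} (hz : z ∈ P) : (z - v) / (a - v) ∈ sector α := by
  obtain ⟨s, t, hs, ht, e⟩ := h.cone z hz
  have e2 : (z - v) / (a - v) = s + t * Complex.exp (α * Complex.I) := by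
    rw [e, h.right_eq]; field_simp [h.ne]
  have e3 : (s + t * Complex.exp (α * Complex.I)) * Complex.exp (-(α * Complex.I)) =
      s * Complex.exp (((-α : ℝ) : ℂ) * Complex.I) + t := by
    rw [add_mul, mul_assoc, ← Complex.exp_add]; simp
  rw [e2, sector, Set.mem_ofPred_eq, e3]
  simp only [Complex.add_im, Complex.ofReal_im, Complex.im_ofReal_mul, Complex.exp_ofReal_mul_I_im,
    Real.sin_neg]
  have := h.sin_pos
  constructor
  · nlinarith
  · nlinarith

/-- In the basis `a - v`, `b - v` the point has nonnegative coordinates, and the distance bound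
makes each at most `1/2`; it lies in the triangle `v`, `a`, `b`. -/
lemma mem_of_mem_sector (h : IsWedge P v a b α) {z : ℂ} (hz : (z - v) / (a - v) ∈ sector α)
    (hr : ‖z - v‖ < ‖a - v‖ * Real.sin α / 2) : z ∈ P := by
  set y := (z - v) / (a - v) with hy
  have hs := h.sin_pos
  have hn : 0 < ‖a - v‖ := norm_pos_iff.2 h.ne
  have hyn : ‖y‖ < Real.sin α / 2 := by
    rw [hy, norm_div, div_lt_iff₀ hn]; linarith
  set t := y.im / Real.sin α with ht
  set s := -(y * Complex.exp (-(α * Complex.I))).im / Real.sin α with hs'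
  have ht0 : 0 ≤ t := div_nonneg hz.1 hs.le
  have hs0 : 0 ≤ s := div_nonneg (neg_nonneg.2 hz.2) hs.le
  have ht1 : t ≤ 1 / 2 := by
    rw [ht, div_le_iff₀ hs]
    linarith [(le_abs_self _).trans (Complex.abs_im_le_norm y)]
  have hs1 : s ≤ 1 / 2 := by
    rw [hs', div_le_iff₀ hs]
    have := (neg_le_abs _).trans (Complex.abs_im_le_norm (y * Complex.exp (-(α * Complex.I))))
    rw [norm_mul, ← neg_mul, ← Complex.ofReal_neg, Complex.norm_exp_ofReal_mul_I, mul_one] at this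
    push_cast at this
    rw [neg_mul] at this
    linarith
  have e : y = s + t * Complex.exp (α * Complex.I) := by
    have e1 : (y * Complex.exp (-(α * Complex.I))).im =
        y.im * Real.cos α - y.re * Real.sin α := by
      rw [← neg_mul, ← Complex.ofReal_neg, Complex.mul_im, Complex.exp_ofReal_mul_I_im,
        Complex.exp_ofReal_mul_I_re, Real.sin_neg, Real.cos_neg]; ring
    rw [hs', ht, e1]
    apply Complex.ext
    · rw [Complex.add_re, Complex.ofReal_re, Complex.re_ofReal_mul, Complex.exp_ofReal_mul_I_re]
      field_simp; ring
    · rw [Complex.add_im, Complex.ofReal_im, Complex.im_ofReal_mul, Complex.exp_ofReal_mul_I_im]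
      field_simp; ring
  have e2 : z = (1 - s - t) • v + s • a + t • b := by
    have h1 : z - v = y * (a - v) := by rw [hy, div_mul_cancel₀ _ h.ne]
    have h2 : z - v = s * (a - v) + t * (b - v) := by
      rw [h1, e, h.right_eq]; ring
    simp only [Complex.real_smul]
    push_cast
    linear_combination h2
  rw [e2]
  have := h.convex.sum_mem (t := Finset.univ) (w := ![1 - s - t, s, t]) (z := ![v, a, b])
    (by intro i _; fin_cases i <;> simp <;> linarith) (by simp [Fin.sum_univ_three]; ring)
    (by intro i _; fin_cases i <;> simp [h.mem, h.left_mem, h.right_mem])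
  simpa [Fin.sum_univ_three] using this

/-- The area of the part of `P` close to the corner `v`. -/
lemma volume_inter_ball (h : IsWedge P v a b α) {r : ℝ} (hr0 : 0 < r)
    (hr : r ≤ ‖a - v‖ * Real.sin α / 2) :
    volume (P ∩ Metric.ball v r) = ENNReal.ofReal (α * (r ^ 2 / 2)) := by
  rw [← volume_sector_inter_ball h.angle_pos h.angle_lt hr0]
  have hn : 0 < ‖a - v‖ := norm_pos_iff.2 h.ne
  -- The isometry `z ↦ D * (z - v)` takes `v` to `0` and `a` to the positive real axis.
  set D : ℂ := (‖a - v‖ : ℂ) / (a - v) with hD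
  have hD1 : ‖D‖ = 1 := by
    rw [hD, norm_div, Complex.norm_real, norm_norm, div_self hn.ne']
  have hmp : MeasurePreserving (fun z : ℂ => D * (z - v)) := by
    have h1 := (rotation ⟨D, by simpa [Submonoid.unitSphere] using hD1⟩ : ℂ ≃ₗᵢ[ℝ] ℂ).measurePreserving
    have h2 := measurePreserving_sub_right (volume : Measure ℂ) v
    exact h1.comp h2
  rw [← hmp.measure_preimage ((measurableSet_sector α).inter
    measurableSet_ball).nullMeasurableSet]
  congr 1
  ext z
  have hsec : D * (z - v) ∈ sector α ↔ (z - v) / (a - v) ∈ sector α := by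
    rw [← smul_mem_sector hn (z := (z - v) / (a - v)), hD]
    congr! 1
    ring
  rw [Set.mem_preimage, Set.mem_inter_iff, Set.mem_inter_iff, mem_ball_zero_iff, norm_mul, hD1,
    one_mul, hsec, mem_ball_iff_norm]
  exact and_congr_left fun hz => ⟨h.mem_sector, fun h' => h.mem_of_mem_sector h' (hz.trans_le hr)⟩

/-- A convex set has a null frontier, but the area close to the corner is positive. -/
lemma interior_nonempty (h : IsWedge P v a b α) : (interior P).Nonempty := by
  by_contra! hi
  have hn : 0 < ‖a - v‖ := norm_pos_iff.2 h.ne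
  have hr : 0 < ‖a - v‖ * Real.sin α / 2 := by have := h.sin_pos; positivity
  have h1 := h.volume_inter_ball hr le_rfl
  have h2 : volume (P ∩ Metric.ball v (‖a - v‖ * Real.sin α / 2)) = 0 := by
    refine measure_mono_null ?_ (h.convex.addHaar_frontier volume)
    intro z hz
    exact ⟨subset_closure hz.1, by simp [hi]⟩
  rw [h2] at h1
  have := h.angle_pos
  have h3 : 0 < α * ((‖a - v‖ * Real.sin α / 2) ^ 2 / 2) := by positivity
  exact absurd (ENNReal.ofReal_eq_zero.1 h1.symm) (not_le.2 h3)

end IsWedge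

/-- The angles of non-overlapping convex sets around a common corner add up to a full turn. -/
lemma sum_angles {S : Finset (Set ℂ)} {v : ℂ} {α : Set ℂ → ℝ}
    (hw : ∀ P ∈ S, ∃ a b, IsWedge P v a b (α P))
    (hd : ∀ P ∈ S, ∀ Q ∈ S, P ≠ Q → Disjoint (interior P) (interior Q))
    (hc : (⋃ P ∈ S, P) ∈ nhds v) : ∑ P ∈ S, α P = 2 * Real.pi := by
  obtain ⟨ε, hε, hball⟩ := Metric.mem_nhds_iff.1 hc
  -- A common radius for all wedges and for the covered disc; additivity of area then reads `π r² =
  -- ∑ α P * r² / 2`.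
  obtain ⟨r, hr, hrε, hrS⟩ : ∃ r > 0, r ≤ ε ∧ ∀ P ∈ S, volume (P ∩ Metric.ball v r) =
      ENNReal.ofReal (α P * (r ^ 2 / 2)) := by
    have hev : ∀ P ∈ S, ∀ᶠ r : ℝ in nhdsWithin 0 (Set.Ioi 0), volume (P ∩ Metric.ball v r) =
        ENNReal.ofReal (α P * (r ^ 2 / 2)) := by
      intro P hP
      obtain ⟨a, b, h⟩ := hw P hP
      have hn : 0 < ‖a - v‖ := norm_pos_iff.2 h.ne
      have hr : 0 < ‖a - v‖ * Real.sin (α P) / 2 := by have := h.sin_pos; positivity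
      filter_upwards [Ioc_mem_nhdsGT hr] with r hr'
      exact h.volume_inter_ball hr'.1 hr'.2
    have hall := (S.eventually_all).2 hev
    obtain ⟨r, h1, h2⟩ := (hall.and (Ioc_mem_nhdsGT hε)).exists
    exact ⟨r, h2.1, h2.2, h1⟩
  have hnull : ∀ P ∈ S, NullMeasurableSet P (volume : Measure ℂ) := by
    intro P hP
    obtain ⟨a, b, h⟩ := hw P hP
    exact h.convex.nullMeasurableSet _
  have hfr : ∀ P ∈ S, volume (frontier P) = 0 := by
    intro P hP
    obtain ⟨a, b, h⟩ := hw P hP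
    exact h.convex.addHaar_frontier _
  have hun : (⋃ P ∈ S, P ∩ Metric.ball v r) = Metric.ball v r := by
    rw [← Set.iUnion₂_inter]
    exact Set.inter_eq_right.2 ((Metric.ball_subset_ball hrε).trans hball)
  have hvol := measure_biUnion_finset₀ (μ := (volume : Measure ℂ)) (s := S)
    (f := fun P => P ∩ Metric.ball v r) ?_
    (fun P hP => (hnull P hP).inter measurableSet_ball.nullMeasurableSet)
  · rw [hun, Finset.sum_congr rfl hrS, ← ENNReal.ofReal_sum_of_nonneg, ← Finset.sum_mul,
      Complex.volume_ball, ← ENNReal.ofReal_pow hr.le] at hvol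
    · have hpi : (NNReal.pi : ENNReal) = ENNReal.ofReal Real.pi := by
        rw [← NNReal.coe_real_pi, ENNReal.ofReal_coe_nnreal]
      have h0 : 0 ≤ ∑ P ∈ S, α P := by
        refine Finset.sum_nonneg fun P hP => ?_
        obtain ⟨a, b, h⟩ := hw P hP
        exact h.angle_pos.le
      rw [hpi, ← ENNReal.ofReal_mul (by positivity),
        ENNReal.ofReal_eq_ofReal_iff (by positivity) (by positivity)] at hvol
      have : r ^ 2 ≠ 0 := by positivity
      field_simp at hvol
      linarith
    · intro P hP
      obtain ⟨a, b, h⟩ := hw P hP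
      have := h.angle_pos
      positivity
  · intro P hP Q hQ hPQ
    refine measure_mono_null (t := frontier P ∪ frontier Q) ?_
      (measure_union_null (hfr P hP) (hfr Q hQ))
    rintro z ⟨⟨hzP, -⟩, hzQ, -⟩
    by_contra hz
    simp only [Set.mem_union, not_or] at hz
    have h1 : z ∈ interior P := by
      by_contra h; exact hz.1 ⟨subset_closure hzP, h⟩
    have h2 : z ∈ interior Q := by
      by_contra h; exact hz.2 ⟨subset_closure hzQ, h⟩
    exact Set.disjoint_left.1 (hd P hP Q hQ hPQ) h1 h2

end EuclideanTiling

/-! ### Unit fraction equations -/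

lemma le_of_le_natCast_inv {n k : ℕ} {r : ℚ} (hr : 0 < r) (h : r ≤ (n : ℚ)⁻¹)
    (hk : r⁻¹ < (k : ℚ) + 1) : n ≤ k := by
  have h1 : (n : ℚ) ≤ r⁻¹ := by
    have := inv_anti₀ hr h
    rwa [inv_inv] at this
  have : (n : ℚ) < k + 1 := lt_of_le_of_lt h1 hk
  exact_mod_cast Nat.lt_succ_iff.1 (by exact_mod_cast this)

lemma natCast_inv_le {m n : ℕ} (hm : 0 < m) (h : m ≤ n) : (n : ℚ)⁻¹ ≤ (m : ℚ)⁻¹ :=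
  inv_anti₀ (by exact_mod_cast hm) (by exact_mod_cast h)

/-- The unit fraction equation of a `3`-valent vertex. -/
lemma three_unit_fractions {a b c : ℕ} (ha : 3 ≤ a) (hab : a ≤ b) (hbc : b ≤ c)
    (h : (a : ℚ)⁻¹ + (b : ℚ)⁻¹ + (c : ℚ)⁻¹ = 1 / 2) :
    (a = 3 ∧ b = 7 ∧ c = 42) ∨ (a = 3 ∧ b = 8 ∧ c = 24) ∨ (a = 3 ∧ b = 9 ∧ c = 18) ∨
    (a = 3 ∧ b = 10 ∧ c = 15) ∨ (a = 3 ∧ b = 12 ∧ c = 12) ∨ (a = 4 ∧ b = 5 ∧ c = 20) ∨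
    (a = 4 ∧ b = 6 ∧ c = 12) ∨ (a = 4 ∧ b = 8 ∧ c = 8) ∨ (a = 5 ∧ b = 5 ∧ c = 10) ∨
    (a = 6 ∧ b = 6 ∧ c = 6) := by
  have h1 := natCast_inv_le (by lia) ha
  have h2 := natCast_inv_le (by lia) hab
  have h3 := natCast_inv_le (by lia) hbc
  -- The largest of three terms with sum `1/2` is at least `1/6`; then `1/b` is at least `(1/2 -
  -- 1/3)/2 = 1/12`.
  have ha6 : a ≤ 6 := le_of_le_natCast_inv (r := 1 / 6) (by norm_num) (by linarith) (by norm_num)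
  have hb12 : b ≤ 12 := by
    norm_num at h1
    exact le_of_le_natCast_inv (r := 1 / 12) (by norm_num) (by linarith) (by norm_num)
  have hc0 : (c : ℚ) ≠ 0 := by have : c ≠ 0 := by lia
                               exact_mod_cast this
  have h' : (b : ℚ) * c + a * c + a * b = a * b * c / 2 := by
    have : (a : ℚ) ≠ 0 := by have : a ≠ 0 := by lia
                             exact_mod_cast this
    have : (b : ℚ) ≠ 0 := by have : b ≠ 0 := by lia
                             exact_mod_cast this
    field_simp at h ⊢; linarith
  have h'' : 2 * (b * c + a * c + a * b) = a * b * c := by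
    have : (2 : ℚ) * (b * c + a * c + a * b) = a * b * c := by linarith
    exact_mod_cast this
  clear h h' h1 h2 h3 hc0
  interval_cases a <;> interval_cases b <;> lia

/-- The unit fraction equation of a `4`-valent vertex. -/
lemma four_unit_fractions {a b c d : ℕ} (ha : 3 ≤ a) (hb : 3 ≤ b) (hc : 3 ≤ c) (hd : 3 ≤ d)
    (h : (a : ℚ)⁻¹ + (b : ℚ)⁻¹ + (c : ℚ)⁻¹ + (d : ℚ)⁻¹ = 1) :
    a = 3 ∨ a = 4 ∨ a = 6 ∨ a = 12 := by
  -- The claim concerns `a` alone, so the other three may be sorted.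
  wlog hbc : b ≤ c generalizing b c
  · exact this hc hb (by linarith) (by lia)
  wlog hcd : c ≤ d generalizing b c d
  · rcases le_total b d with h' | h'
    · exact this hc hb hd (by linarith) h' (by lia)
    · exact this hc hd hb (by linarith) h' (by lia)
  have h1 := natCast_inv_le (by lia) ha
  have h2 := natCast_inv_le (by lia) hbc
  have h3 := natCast_inv_le (by lia) hcd
  norm_num at h1
  have hb4 : b ≤ 4 := le_of_le_natCast_inv (r := 2 / 9) (by norm_num) (by linarith) (by norm_num)
  have h4 := natCast_inv_le (by lia) hb
  norm_num at h4
  have hc6 : c ≤ 6 := le_of_le_natCast_inv (r := 1 / 6) (by norm_num) (by linarith) (by norm_num)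
  have h'' : b * c * d + a * c * d + a * b * d + a * b * c = a * b * c * d := by
    have : (a : ℚ) ≠ 0 := by have : a ≠ 0 := by lia
                             exact_mod_cast this
    have : (b : ℚ) ≠ 0 := by have : b ≠ 0 := by lia
                             exact_mod_cast this
    have : (c : ℚ) ≠ 0 := by have : c ≠ 0 := by lia
                             exact_mod_cast this
    have : (d : ℚ) ≠ 0 := by have : d ≠ 0 := by lia
                             exact_mod_cast this
    field_simp at h
    have h5 : (b : ℚ) * c * d + a * c * d + a * b * d + a * b * c = a * b * c * d := by linarith
    exact_mod_cast h5
  clear h h1 h2 h3 h4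
  -- Three triangles would leave `1/d = 0`; without this case `1/d ≥ 1/12`.
  have ha4 : b = 3 → c = 3 → 4 ≤ a := by
    rintro rfl rfl
    by_contra h6
    obtain rfl : a = 3 := by lia
    lia
  have hd12 : d ≤ 12 := by
    interval_cases b <;> interval_cases c <;> simp at ha4 <;> nlinarith
  interval_cases b <;> interval_cases c <;> interval_cases d <;> lia

/-! ### Abstract flags and the exclusion of tile sizes -/

/-- The flags of a polygonal complex, with the involutions that change the vertex, the edge and the
tile of a flag, and the number of sides of the tile of a flag. -/
structure FlagSystem (F : Type*) where
  s0 : F → F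
  s1 : F → F
  s2 : F → F
  size : F → ℕ
  s0_s0 : ∀ f, s0 (s0 f) = f
  s1_s1 : ∀ f, s1 (s1 f) = f
  s2_s2 : ∀ f, s2 (s2 f) = f
  s0_s2 : ∀ f, s0 (s2 f) = s2 (s0 f)
  size_s0 : ∀ f, size (s0 f) = size f
  size_s1 : ∀ f, size (s1 f) = size f
  three_le_size : ∀ f, 3 ≤ size f
  rotate_size : ∀ f, (fun g => s1 (s0 g))^[size f] f = f

namespace FlagSystem

variable {F : Type*} (S : FlagSystem F)

/-- The vertex of `f` is `3`-valent and the angles around it add up to a full turn. -/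
def Three (f : F) : Prop :=
  (S.size f : ℚ)⁻¹ + (S.size (S.s2 f) : ℚ)⁻¹ + (S.size (S.s2 (S.s1 f)) : ℚ)⁻¹ = 1 / 2

/-- The vertex of `f` is `4`-valent and the angles around it add up to a full turn. -/
def Four (f : F) : Prop :=
  S.s1 (S.s2 (S.s1 (S.s2 f))) = S.s2 (S.s1 (S.s2 (S.s1 f))) ∧
  (S.size f : ℚ)⁻¹ + (S.size (S.s2 f) : ℚ)⁻¹ + (S.size (S.s2 (S.s1 f)) : ℚ)⁻¹ +
    (S.size (S.s2 (S.s1 (S.s2 f))) : ℚ)⁻¹ = 1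

variable {S}

lemma Four.size_mem {f : F} (h : S.Four f) :
    (S.size f = 3 ∨ S.size f = 4 ∨ S.size f = 6 ∨ S.size f = 12) ∧
    (S.size (S.s2 f) = 3 ∨ S.size (S.s2 f) = 4 ∨ S.size (S.s2 f) = 6 ∨ S.size (S.s2 f) = 12) ∧
    (S.size (S.s2 (S.s1 f)) = 3 ∨ S.size (S.s2 (S.s1 f)) = 4 ∨ S.size (S.s2 (S.s1 f)) = 6 ∨
      S.size (S.s2 (S.s1 f)) = 12) ∧
    (S.size (S.s2 (S.s1 (S.s2 f))) = 3 ∨ S.size (S.s2 (S.s1 (S.s2 f))) = 4 ∨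
      S.size (S.s2 (S.s1 (S.s2 f))) = 6 ∨ S.size (S.s2 (S.s1 (S.s2 f))) = 12) := by
  have t := S.three_le_size
  refine ⟨four_unit_fractions (t _) (t _) (t _) (t _) h.2,
    four_unit_fractions (t _) (t _) (t _) (t _) (b := S.size f) (c := S.size (S.s2 (S.s1 f)))
      (d := S.size (S.s2 (S.s1 (S.s2 f)))) ?_,
    four_unit_fractions (t _) (t _) (t _) (t _) (b := S.size f) (c := S.size (S.s2 f))
      (d := S.size (S.s2 (S.s1 (S.s2 f)))) ?_,
    four_unit_fractions (t _) (t _) (t _) (t _) (b := S.size f) (c := S.size (S.s2 f))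
      (d := S.size (S.s2 (S.s1 f))) ?_⟩ <;> linarith [h.2]

/-- Half of the relation `(s1 s0)³ = 1` moved across: the third side of a triangle is reached from
either end of the first. -/
lemma rotate_three {f : F} (h : S.size f = 3) :
    S.s1 (S.s0 (S.s1 f)) = S.s0 (S.s1 (S.s0 f)) := by
  have := S.rotate_size f
  rw [h] at this
  simp only [Function.iterate_succ, Function.iterate_zero, Function.comp, id] at this
  have h2 := congrArg (fun g => S.s1 (S.s0 (S.s1 g))) this
  simp only [S.s1_s1, S.s0_s0] at h2
  exact h2.symm

lemma rotate_four {f : F} (h : S.size f = 4) :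
    S.s1 (S.s0 (S.s1 (S.s0 f))) = S.s0 (S.s1 (S.s0 (S.s1 f))) := by
  have := S.rotate_size f
  rw [h] at this
  simp only [Function.iterate_succ, Function.iterate_zero, Function.comp, id] at this
  have h2 := congrArg (fun g => S.s0 (S.s1 (S.s0 (S.s1 g)))) this
  simp only [S.s1_s1, S.s0_s0] at h2
  exact h2

/-- If the size `n` is odd and not 3, all vertices of the tile are 3-valent. Consecutive tiles
across its sides have reciprocals with a constant sum, so these alternate; `n` being odd, they
agree. If `m` is the common size, `1/n + 2/m = 1/2`. -/
lemma eq_three_of_odd (hv : ∀ f, S.Three f ∨ S.Four f) {f : F} (ho : Odd (S.size f)) :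
    S.size f = 3 := by
  by_contra hne
  obtain ⟨n, hn⟩ : ∃ n, S.size f = n := ⟨_, rfl⟩
  rw [hn] at ho hne
  have h3 : ∀ g, S.size g = n → S.Three g := by
    intro g hg
    rcases hv g with h | h
    · exact h
    · have := h.size_mem.1
      rw [hg] at this
      rcases ho with ⟨k, rfl⟩
      lia
  have hn5 : 3 ≤ n := hn ▸ S.three_le_size f
  set R : F → F := fun g => S.s1 (S.s0 g) with hR
  have hsz : ∀ i, S.size (R^[i] f) = n := by
    intro i
    induction i with
    | zero => exact hn
    | succ i ih => rw [Function.iterate_succ_apply', hR]; simp only [S.size_s0, S.size_s1]; exact ih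
  set a : ℕ → ℚ := fun i => (S.size (S.s2 (R^[i] f)) : ℚ)⁻¹ with ha
  have key : ∀ i, (n : ℚ)⁻¹ + a i + a (i + 1) = 1 / 2 := by
    intro i
    have := h3 (S.s0 (R^[i] f)) (by rw [S.size_s0]; exact hsz i)
    rw [Three, S.size_s0, hsz i, ← S.s0_s2, S.size_s0] at this
    simp only [ha, Function.iterate_succ_apply']
    exact this
  have per : ∀ i, a (2 * i) = a 0 := by
    intro i
    induction i with
    | zero => rfl
    | succ i ih =>
      have h1 := key (2 * i)
      have h2 := key (2 * i + 1)
      rw [show 2 * (i + 1) = 2 * i + 1 + 1 by ring]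
      linarith
  have hn0 : a n = a 0 := by
    have := S.rotate_size f
    rw [hn] at this
    simp only [ha]
    rw [hR, this]; rfl
  obtain ⟨k, rfl⟩ := ho
  have h1 := key (2 * k)
  rw [hn0, per] at h1
  simp only [ha] at h1
  have hm := S.three_le_size (S.s2 (R^[0] f))
  set m := S.size (S.s2 (R^[0] f))
  have h2 : 2 * (m + 2 * (2 * k + 1)) = m * (2 * k + 1) := by
    have : (m : ℚ) ≠ 0 := by have : m ≠ 0 := by lia
                             exact_mod_cast this
    have h5 : ((2 * k + 1 : ℕ) : ℚ) ≠ 0 := by positivity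
    field_simp at h1
    have h6 : (2 : ℚ) * (m + 2 * (2 * k + 1 : ℕ)) = m * (2 * k + 1 : ℕ) := by linarith
    exact_mod_cast h6
  obtain ⟨j, rfl⟩ : ∃ j, k = j + 1 := ⟨k - 1, by lia⟩
  -- With `n = 2j + 3` the equation is `m (n - 2) = 4n = 4 (n - 2) + 8`.
  have h4 : (2 * j + 1) ∣ 8 := by
    refine (Nat.dvd_add_right (b := 4 * (2 * j + 1)) ⟨4, by ring⟩).1 ⟨m, ?_⟩
    linarith
  have h5 : 2 * j + 1 ≤ 8 := Nat.le_of_dvd (by norm_num) h4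
  have h6 : j ≤ 3 := by lia
  interval_cases j <;> simp_all

/-- If the angles add up at all vertices and all of these are of valence `3` or `4`, then only five
kinds of regular polygons occur. -/
theorem size_mem_of_three_or_four (hv : ∀ f, S.Three f ∨ S.Four f) (f : F) :
    S.size f ∈ ({3, 4, 6, 8, 12} : Set ℕ) := by
  have hodd : ∀ g, S.size g = 3 ∨ Even (S.size g) := by
    intro g
    rcases Nat.even_or_odd (S.size g) with h | h
    · exact Or.inr h
    · exact Or.inl (eq_three_of_odd hv h)
  -- Of the ten triples, parity removes those with an odd entry other than 3; the only bad survivor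
  -- is 3.8.24.
  have list : ∀ g, S.Three g → S.size g ∈ ({3, 4, 6, 8, 12} : Set ℕ) ∨ (S.size g = 24 ∧
      ((S.size (S.s2 g) = 3 ∧ S.size (S.s2 (S.s1 g)) = 8) ∨
      (S.size (S.s2 g) = 8 ∧ S.size (S.s2 (S.s1 g)) = 3))) := by
    intro g h
    have o1 := hodd g
    have o2 := hodd (S.s2 g)
    have o3 := hodd (S.s2 (S.s1 g))
    have t1 := S.three_le_size g
    have t2 := S.three_le_size (S.s2 g)
    have t3 := S.three_le_size (S.s2 (S.s1 g))
    unfold Three at h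
    generalize S.size g = a at *
    generalize S.size (S.s2 g) = b at *
    generalize S.size (S.s2 (S.s1 g)) = c at *
    have hor : (a ≤ b ∧ b ≤ c) ∨ (a ≤ c ∧ c ≤ b) ∨ (b ≤ a ∧ a ≤ c) ∨ (b ≤ c ∧ c ≤ a) ∨
      (c ≤ a ∧ a ≤ b) ∨ (c ≤ b ∧ b ≤ a) := by lia
    rcases hor with ⟨h1, h2⟩ | ⟨h1, h2⟩ | ⟨h1, h2⟩ | ⟨h1, h2⟩ | ⟨h1, h2⟩ | ⟨h1, h2⟩
    · have := three_unit_fractions t1 h1 h2 (by linarith)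
      clear h
      rcases this with h | h | h | h | h | h | h | h | h | h <;> obtain ⟨rfl, rfl, rfl⟩ := h <;>
        revert o1 o2 o3 <;> simp <;> decide
    · have := three_unit_fractions t1 h1 h2 (by linarith)
      clear h
      rcases this with h | h | h | h | h | h | h | h | h | h <;> obtain ⟨rfl, rfl, rfl⟩ := h <;>
        revert o1 o2 o3 <;> simp <;> decide
    · have := three_unit_fractions t2 h1 h2 (by linarith)
      clear h
      rcases this with h | h | h | h | h | h | h | h | h | h <;> obtain ⟨rfl, rfl, rfl⟩ := h <;>
        revert o1 o2 o3 <;> simp <;> decide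
    · have := three_unit_fractions t2 h1 h2 (by linarith)
      clear h
      rcases this with h | h | h | h | h | h | h | h | h | h <;> obtain ⟨rfl, rfl, rfl⟩ := h <;>
        revert o1 o2 o3 <;> simp <;> decide
    · have := three_unit_fractions t3 h1 h2 (by linarith)
      clear h
      rcases this with h | h | h | h | h | h | h | h | h | h <;> obtain ⟨rfl, rfl, rfl⟩ := h <;>
        revert o1 o2 o3 <;> simp <;> decide
    · have := three_unit_fractions t3 h1 h2 (by linarith)
      clear h
      rcases this with h | h | h | h | h | h | h | h | h | h <;> obtain ⟨rfl, rfl, rfl⟩ := h <;>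
        revert o1 o2 o3 <;> simp <;> decide
  -- A 24-gon has no 4-valent vertices, so at both ends of a side shared with a triangle the third
  -- tile is an octagon. The apex of the triangle then lies in two octagons, yet 8 does not occur at
  -- valence 4 and `1/3 + 1/8 + 1/8 ≠ 1/2`.
  have no24 : ∀ g, S.size g = 24 → S.size (S.s2 g) = 3 → False := by
    intro g hg h3
    have third : ∀ g, S.size g = 24 → S.size (S.s2 g) = 3 → S.size (S.s2 (S.s1 g)) = 8 ∧
        S.size (S.s2 (S.s1 (S.s2 g))) = 8 := by
      intro g hg h3
      have hT : ∀ g, S.size g = 24 → S.Three g := by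
        intro g hg
        rcases hv g with h | h
        · exact h
        · have := h.size_mem.1
          lia
      have h1 := list g (hT g hg)
      rw [hg] at h1
      have h8 : S.size (S.s2 (S.s1 g)) = 8 := by
        rcases h1 with h1 | h1
        · simp at h1
        · rcases h1.2 with h | h
          · exact h.2
          · lia
      refine ⟨h8, ?_⟩
      rcases hv (S.s2 g) with h | h
      · rw [Three, S.s2_s2, hg, h3] at h
        have h9 : (S.size (S.s2 (S.s1 (S.s2 g))) : ℚ)⁻¹ = (8 : ℚ)⁻¹ := by
          push_cast at h; linarith
        exact_mod_cast inv_injective h9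
      · have := h.size_mem.2.1
        rw [S.s2_s2] at this
        lia
    have a1 := (third g hg h3).2
    have a2 := (third (S.s0 g) (by rw [S.size_s0, hg]) (by rw [← S.s0_s2, S.size_s0, h3])).2
    set t := S.s2 g with ht
    rw [← S.s0_s2] at a2
    have e1 : S.size (S.s0 (S.s1 t)) = 3 := by rw [S.size_s0, S.size_s1, h3]
    have e2 : S.size (S.s2 (S.s0 (S.s1 t))) = 8 := by rw [← S.s0_s2, S.size_s0, a1]
    have e3 : S.size (S.s2 (S.s1 (S.s0 (S.s1 t)))) = 8 := by
      rw [rotate_three h3, ← S.s0_s2, S.size_s0]; exact a2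
    rcases hv (S.s0 (S.s1 t)) with h | h
    · rw [Three, e1, e2, e3] at h
      norm_num at h
    · have := h.size_mem.2.1
      lia
  rcases hv f with h | h
  · rcases list f h with h1 | ⟨h1, h2⟩
    · exact h1
    · exfalso
      rcases h2 with h2 | h2
      · exact no24 f h1 h2.1
      · exact no24 (S.s1 f) (by rw [S.size_s1, h1]) h2.2
  · rcases h.size_mem.1 with h | h | h | h <;> simp [h]

/-- If moreover all vertices are `4`-valent, there are no octagons and no dodecagons. -/
theorem size_mem_of_four (hv : ∀ f, S.Four f) (f : F) :
    S.size f = 3 ∨ S.size f = 4 ∨ S.size f = 6 := by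
  have sum := fun g => (hv g).2
  have mem := fun g => (hv g).size_mem
  have comm := fun g => (hv g).1
  have comm' : ∀ g, S.size (S.s2 (S.s1 (S.s2 (S.s1 g)))) = S.size (S.s2 (S.s1 (S.s2 g))) := by
    intro g; rw [← comm, S.size_s1]
  -- At the vertex of `g`, `s2 g` and `s2 (s1 g)` belong to the two neighbours of its tile and `s2
  -- (s1 (s2 g))` to the opposite tile. A dodecagon comes with two triangles and a square, in one of
  -- three positions.
  have v12 : ∀ g, S.size g = 12 →
      (S.size (S.s2 g) = 4 ∧ S.size (S.s2 (S.s1 g)) = 3 ∧ S.size (S.s2 (S.s1 (S.s2 g))) = 3) ∨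
      (S.size (S.s2 g) = 3 ∧ S.size (S.s2 (S.s1 g)) = 4 ∧ S.size (S.s2 (S.s1 (S.s2 g))) = 3) ∨
      (S.size (S.s2 g) = 3 ∧ S.size (S.s2 (S.s1 g)) = 3 ∧ S.size (S.s2 (S.s1 (S.s2 g))) = 4) := by
    intro g hg
    have h := sum g
    obtain ⟨-, m2, m3, m4⟩ := mem g
    rw [hg] at h
    rcases m2 with h2 | h2 | h2 | h2 <;> rcases m3 with h3 | h3 | h3 | h3 <;>
      rcases m4 with h4 | h4 | h4 | h4 <;> rw [h2, h3, h4] at h <;> norm_num at h <;>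
      simp [h2, h3, h4]
  have twelve : ∀ x : ℕ, (x : ℚ)⁻¹ = 1 / 12 → x = 12 := by
    intro x hx
    have : (x : ℚ)⁻¹ = (12 : ℚ)⁻¹ := by rw [hx]; norm_num
    exact_mod_cast inv_injective this
  have nosq : ∀ g, S.size g = 12 → S.size (S.s2 g) ≠ 4 := by
    -- If a dodecagon and a square share a side, the tile across the opposite side of the square is
    -- a triangle, with a dodecagon across its next side.
    have claim : ∀ g, S.size g = 12 → S.size (S.s2 g) = 4 →
        S.size (S.s2 (S.s1 (S.s0 (S.s1 (S.s2 g))))) = 3 ∧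
        S.size (S.s2 (S.s1 (S.s2 (S.s1 (S.s0 (S.s1 (S.s2 g))))))) = 12 := by
      intro g hg h4
      obtain ⟨d3, c3⟩ : S.size (S.s2 (S.s1 g)) = 3 ∧ S.size (S.s2 (S.s1 (S.s2 g))) = 3 := by
        have := v12 g hg
        lia
      have hk := v12 (S.s0 (S.s1 g)) (by rw [S.size_s0, S.size_s1, hg])
      rw [← S.s0_s2, S.size_s0, d3] at hk
      have hh := sum (S.s0 (S.s1 (S.s2 (S.s1 g))))
      have e1 : S.size (S.s0 (S.s1 (S.s2 (S.s1 g)))) = 3 := by rw [S.size_s0, S.size_s1, d3]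
      have e2 : S.size (S.s2 (S.s0 (S.s1 (S.s2 (S.s1 g))))) = 3 := by
        rw [← S.s0_s2, S.size_s0, comm', c3]
      have e3 : S.size (S.s2 (S.s1 (S.s0 (S.s1 (S.s2 (S.s1 g)))))) =
          S.size (S.s2 (S.s1 (S.s0 (S.s2 (S.s1 g))))) := by
        rw [rotate_three d3, ← S.s0_s2, S.size_s0]
      have m4 := (mem (S.s0 (S.s1 (S.s2 (S.s1 g))))).2.2.2
      rw [e1, e2, e3] at hh
      -- The apex of the triangle `s2 (s1 g)` lies in a second triangle and in the tile across the
      -- third side, which is a triangle or a square. A third triangle is impossible, and a square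
      -- leaves a dodecagon.
      have h12 : S.size (S.s2 (S.s1 (S.s2 (S.s0 (S.s1 (S.s2 (S.s1 g))))))) = 12 := by
        rcases hk with hk | hk | hk
        · lia
        · exfalso
          rw [hk.2.2] at hh
          rcases m4 with h | h | h | h <;> rw [h] at hh <;> norm_num at hh
        · rw [hk.2.2] at hh
          apply twelve
          norm_num at hh ⊢
          linarith
      -- The same dodecagon, seen across the third side of the other triangle `s2 (s1 (s2 g))`. That
      -- side ends at a corner of the square, where 4, 3 and 12 leave a triangle.
      have e4 : S.size (S.s2 (S.s1 (S.s0 (S.s2 (S.s1 (S.s2 g)))))) = 12 := by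
        rw [← S.s0_s2, ← comm, rotate_three c3, ← S.s0_s2, S.size_s0] at h12
        exact h12
      rw [S.s0_s2] at e4
      have hu := sum (S.s0 (S.s1 (S.s2 g)))
      rw [S.size_s0, S.size_s1, h4, ← S.s0_s2, S.size_s0, c3, S.s0_s2, e4] at hu
      refine ⟨?_, by rw [comm', e4]⟩
      have : (S.size (S.s2 (S.s1 (S.s0 (S.s1 (S.s2 g))))) : ℚ)⁻¹ = (3 : ℚ)⁻¹ := by
        push_cast at hu
        linarith
      exact_mod_cast inv_injective this
    intro g hg h4
    -- From both ends of the shared side, dodecagons lie across two sides of the triangle beyond the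
    -- square; where these sides meet, the fourth reciprocal would be `1/2`.
    have hA := claim g hg h4
    have hB := claim (S.s0 g) (by rw [S.size_s0, hg]) (by rw [← S.s0_s2, S.size_s0, h4])
    rw [← S.s0_s2, rotate_four h4, ← S.s0_s2] at hB
    set z := S.s2 (S.s1 (S.s0 (S.s1 (S.s2 g))))
    have hh := sum (S.s0 (S.s1 z))
    rw [S.size_s0, S.size_s1, hA.1, ← S.s0_s2, S.size_s0, hA.2, rotate_three hA.1, ← S.s0_s2,
      S.size_s0, hB.2] at hh
    rcases (mem (S.s0 (S.s1 z))).2.2.2 with h | h | h | h <;> rw [← S.s0_s2] at h <;>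
      rw [h] at hh <;> norm_num at hh
  have no12 : ∀ g, S.size g ≠ 12 := by
    intro g hg
    -- With no square beside a dodecagon, the square must be opposite it at each vertex.
    have hv12 : ∀ g, S.size g = 12 → S.size (S.s2 (S.s1 (S.s2 g))) = 4 := by
      intro g hg
      have h1 := nosq g hg
      have h2 := nosq (S.s1 g) (by rw [S.size_s1, hg])
      have := v12 g hg
      lia
    -- A triangle beside the dodecagon has squares across its two other sides, so the fourth tile at
    -- its apex is a hexagon.
    have hex : ∀ g, S.size g = 12 → S.size (S.s2 (S.s1 (S.s0 (S.s2 (S.s1 (S.s2 g)))))) = 6 := by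
      intro g hg
      have h3 : S.size (S.s2 g) = 3 := by
        have h1 := nosq g hg
        have := v12 g hg
        lia
      have hh := sum (S.s0 (S.s1 (S.s2 g)))
      have h0 := hv12 (S.s0 g) (by rw [S.size_s0, hg])
      rw [← S.s0_s2] at h0
      rw [S.size_s0, S.size_s1, h3, ← S.s0_s2, S.size_s0, hv12 g hg, rotate_three h3, ← S.s0_s2,
        S.size_s0, h0] at hh
      have : (S.size (S.s2 (S.s1 (S.s0 (S.s2 (S.s1 (S.s2 g)))))) : ℚ)⁻¹ = (6 : ℚ)⁻¹ := by
        norm_num at hh ⊢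
        linarith
      exact_mod_cast inv_injective this
    have h1 := hex g hg
    have h2 := hex (S.s1 g) (by rw [S.size_s1, hg])
    rw [← comm] at h2
    have h4 := hv12 g hg
    set m := S.s2 (S.s1 (S.s2 g))
    -- The corner of the square diagonally opposite the dodecagon: hexagons across both sides there
    -- leave `5/12`, not a unit fraction.
    have hh := sum (S.s0 (S.s1 (S.s0 m)))
    have e : S.size (S.s2 (S.s1 (S.s0 (S.s1 (S.s0 m))))) = 6 := by
      rw [rotate_four h4, ← S.s0_s2, S.size_s0, h2]
    have m4 := (mem (S.s0 (S.s1 (S.s0 m)))).2.2.2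
    rw [e, S.size_s0, S.size_s1, S.size_s0, h4, ← S.s0_s2, S.size_s0, h1] at hh
    rw [← S.s0_s2] at m4
    rcases m4 with h | h | h | h <;> rw [h] at hh <;> norm_num at hh
  have := (mem f).1
  have := no12 f
  lia

end FlagSystem

/-! ### Cyclic order of the corners of a regular polygon -/

namespace EuclideanTiling

lemma IsRegularPolygon.interior_nonempty {n : ℕ} {P : Set ℂ} (h : IsRegularPolygon n P) :
    (interior P).Nonempty := by
  have hn := h.1
  obtain ⟨c, w, hw, rfl⟩ := h.exists_eq
  exact (isWedge_ngon hn hw).interior_nonempty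

lemma IsRegularPolygon.exists_wedge {n : ℕ} {P : Set ℂ} (h : IsRegularPolygon n P) {v : ℂ}
    (hv : v ∈ corners P) : ∃ a b, IsWedge P v a b (Real.pi - 2 * Real.pi / n) := by
  have hn := h.1
  obtain ⟨c, w, hw, rfl⟩ := h.exists_eq
  rw [corners_ngon hn hw] at hv
  obtain ⟨k, rfl⟩ := hv
  exact ⟨_, _, isWedge_ngon_shift hn hw k⟩

/-- The cyclic list of the corners of a regular polygon. -/
lemma IsRegularPolygon.exists_cyclic {n : ℕ} {P : Set ℂ} (h : IsRegularPolygon n P) :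
    ∃ p : ℤ → ℂ, corners P = Set.range p ∧ (∀ j k, p j = p k ↔ (n : ℤ) ∣ j - k) ∧
      ∀ k x, Nbr P (p k) x ↔ x = p (k + 1) ∨ x = p (k - 1) := by
  have hn := h.1
  have hi := h.interior_nonempty
  obtain ⟨c, w, hw, rfl⟩ := h.exists_eq
  have hc := corners_ngon hn (c := c) hw
  refine ⟨ngonCorner n c w, hc, ngonCorner_eq_iff (by lia) hw, fun k x => ?_⟩
  have hwed := isWedge_ngon_shift hn (c := c) hw k
  constructor
  · exact hwed.eq_of_nbr hi (by rw [hc]; exact ⟨_, rfl⟩) (by rw [hc]; exact ⟨_, rfl⟩)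
  · rintro (rfl | rfl)
    · exact hwed.nbr_left (by rw [hc]; exact ⟨_, rfl⟩)
    · exact hwed.nbr_right (by rw [hc]; exact ⟨_, rfl⟩)

lemma IsRegularPolygon.exists_nbr_pair {n : ℕ} {P : Set ℂ} (h : IsRegularPolygon n P) {v : ℂ}
    (hv : v ∈ corners P) : ∃ a b, a ≠ b ∧ ∀ x, Nbr P v x ↔ x = a ∨ x = b := by
  obtain ⟨p, hp, heq, hnbr⟩ := h.exists_cyclic
  rw [hp] at hv
  obtain ⟨k, rfl⟩ := hv
  refine ⟨_, _, ?_, hnbr k⟩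
  rw [Ne, heq]
  intro hd
  have := Int.le_of_dvd (by lia) hd
  have := h.1
  lia

end EuclideanTiling

/-! ### The flags of a tiling -/

namespace RegularPolygonTiling

open EuclideanTiling

variable {T : RegularPolygonTiling}

/-- The number of sides of a convex polygon. -/
noncomputable def sides (P : Set ℂ) : ℕ := (corners P).ncard

lemma isRegularPolygon_sides {P : Set ℂ} (hP : P ∈ T.tiles) : IsRegularPolygon (sides P) P := by
  obtain ⟨n, hn⟩ := T.regular P hP
  rwa [sides, hn.ncard_corners]

lemma isRegularPolygon_iff {P : Set ℂ} (hP : P ∈ T.tiles) {n : ℕ} :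
    IsRegularPolygon n P ↔ sides P = n :=
  ⟨fun h => (isRegularPolygon_sides hP).unique h, fun h => h ▸ isRegularPolygon_sides hP⟩

lemma isClosed_tile {P : Set ℂ} (hP : P ∈ T.tiles) : IsClosed P :=
  (isRegularPolygon_sides hP).isCompact.isClosed

/-- The tiles that contain a point. -/
def tilesAt (T : RegularPolygonTiling) (v : ℂ) : Set (Set ℂ) := {P | P ∈ T.tiles ∧ v ∈ P}

lemma finite_tilesAt (v : ℂ) : (T.tilesAt v).Finite := by
  have := (T.locallyFinite.point_finite v).image Subtype.val
  refine this.subset ?_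
  rintro P ⟨hP, hv⟩
  exact ⟨⟨P, hP⟩, hv, rfl⟩

lemma isClosed_iUnion_tiles (s : Set (Set ℂ)) (hs : s ⊆ T.tiles) : IsClosed (⋃ P ∈ s, P) := by
  have h1 : LocallyFinite fun P : s => (P : Set ℂ) :=
    T.locallyFinite.comp_injective (Set.inclusion_injective hs)
  rw [Set.biUnion_eq_iUnion]
  exact h1.isClosed_iUnion fun P => isClosed_tile (hs P.2)

lemma iUnion_tilesAt_mem_nhds (v : ℂ) : (⋃ P ∈ T.tilesAt v, P) ∈ nhds v := by
  have h1 : IsClosed (⋃ P ∈ {P | P ∈ T.tiles ∧ v ∉ P}, P) :=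
    isClosed_iUnion_tiles _ fun P hP => hP.1
  refine Filter.mem_of_superset (h1.isOpen_compl.mem_nhds ?_) ?_
  · simp only [Set.mem_compl_iff, Set.mem_iUnion, not_exists]
    exact fun P hP hv => hP.2 hv
  · intro z hz
    have : z ∈ ⋃₀ T.tiles := by rw [T.covers]; trivial
    obtain ⟨P, hP, hzP⟩ := this
    simp only [Set.mem_compl_iff, Set.mem_iUnion, not_exists] at hz
    simp only [Set.mem_iUnion]
    refine ⟨P, ⟨hP, ?_⟩, hzP⟩
    by_contra hv
    exact hz P ⟨hP, hv⟩ hzP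

/-- Being edge-to-edge, the tiles meet in a common corner or a common side; in the latter case a
corner of `P` in this side is one of its ends. -/
lemma corner_of_mem (hee : T.IsEdgeToEdge) {P Q : Set ℂ} {v : ℂ} (hP : P ∈ T.tiles)
    (hQ : Q ∈ T.tiles) (hv : v ∈ corners P) (hvQ : v ∈ Q) : v ∈ corners Q := by
  rcases eq_or_ne P Q with rfl | hPQ
  · exact hv
  have hmem : v ∈ P ∩ Q := ⟨corners_subset P hv, hvQ⟩
  rcases hee P hP Q hQ hPQ with h | ⟨u, hu, h⟩ | ⟨h1, h2⟩
  · simp [h] at hmem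
  · rw [h] at hmem
    obtain rfl : v = u := hmem
    exact hu.2
  · obtain ⟨a, b, hab, he⟩ := h1.exists_nbr
    rw [he] at h2 hmem
    have h3 := nbr_of_isSide_segment h2
    rcases corner_mem_segment hv (corners_subset P hab.1) (corners_subset P hab.2.1) hmem with
      rfl | rfl
    · exact h3.1
    · exact h3.2.1

/-- Distinct tiles have at most two common corners. -/
lemma eq_of_common_corners (hee : T.IsEdgeToEdge) {P Q : Set ℂ} {v x y : ℂ} (hP : P ∈ T.tiles)
    (hQ : Q ∈ T.tiles) (hPQ : P ≠ Q) (hv : v ∈ corners P) (hx : x ∈ corners P)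
    (hy : y ∈ corners P) (hvQ : v ∈ Q) (hxQ : x ∈ Q) (hyQ : y ∈ Q) (hvx : v ≠ x) (hvy : v ≠ y) :
    x = y := by
  have hs := corners_subset P
  have mv : v ∈ P ∩ Q := ⟨hs hv, hvQ⟩
  have mx : x ∈ P ∩ Q := ⟨hs hx, hxQ⟩
  have my : y ∈ P ∩ Q := ⟨hs hy, hyQ⟩
  rcases hee P hP Q hQ hPQ with h | ⟨u, hu, h⟩ | ⟨h1, h2⟩
  · simp [h] at mv
  · rw [h] at mv mx
    exact absurd (Eq.trans mv (Eq.symm mx)) hvx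
  · obtain ⟨a, b, hab, he⟩ := h1.exists_nbr
    rw [he] at mv mx my
    have ha := hs hab.1
    have hb := hs hab.2.1
    have k1 := corner_mem_segment hv ha hb mv
    have k2 := corner_mem_segment hx ha hb mx
    have k3 := corner_mem_segment hy ha hb my
    grind

/-- There is another tile on each side of a tile. -/
lemma exists_across (hee : T.IsEdgeToEdge) {P : Set ℂ} {v x : ℂ} (hP : P ∈ T.tiles)
    (h : Nbr P v x) : ∃ Q ∈ T.tiles, Q ≠ P ∧ Nbr Q v x := by
  have hreg := isRegularPolygon_sides hP
  -- The midpoint is a limit of points outside `P`, and the union of the other tiles is closed by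
  -- local finiteness, so some other tile contains `m`. As `m` is no corner, the two tiles share the
  -- side through it.
  set m : ℂ := (1 / 2 : ℝ) • v + (1 / 2 : ℝ) • x with hm
  have hmo : m ∈ openSegment ℝ v x := ⟨1 / 2, 1 / 2, by norm_num, by norm_num, by norm_num, rfl⟩
  have hmf := h.2.2.2 (openSegment_subset_segment _ _ _ hmo)
  have hmP : m ∈ P := (isClosed_tile hP).frontier_subset hmf
  have hcl : m ∈ closure Pᶜ := by
    rw [frontier_eq_closure_inter_closure] at hmf
    exact hmf.2
  have hcl2 : IsClosed (⋃ Q ∈ {Q | Q ∈ T.tiles ∧ Q ≠ P}, Q) :=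
    isClosed_iUnion_tiles _ fun Q hQ => hQ.1
  have hmem : m ∈ ⋃ Q ∈ {Q | Q ∈ T.tiles ∧ Q ≠ P}, Q := by
    refine closure_minimal ?_ hcl2 hcl
    intro z hz
    have : z ∈ ⋃₀ T.tiles := by rw [T.covers]; trivial
    obtain ⟨Q, hQ, hzQ⟩ := this
    simp only [Set.mem_iUnion]
    refine ⟨Q, ⟨hQ, ?_⟩, hzQ⟩
    rintro rfl
    exact hz hzQ
  simp only [Set.mem_iUnion] at hmem
  obtain ⟨Q, ⟨hQ, hQP⟩, hmQ⟩ := hmem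
  refine ⟨Q, hQ, hQP, ?_⟩
  rcases hee P hP Q hQ hQP.symm with h0 | ⟨u, hu, h0⟩ | ⟨h1, h2⟩
  · have : m ∈ P ∩ Q := ⟨hmP, hmQ⟩
    simp [h0] at this
  · have : m ∈ P ∩ Q := ⟨hmP, hmQ⟩
    rw [h0] at this
    obtain rfl : m = u := this
    have := (mem_extremePoints.1 hu.1).2 v (corners_subset P h.1) x (corners_subset P h.2.1) hmo
    exact absurd (this.1.trans this.2.symm) h.2.2.1
  · obtain ⟨a, b, hab, he⟩ := h1.exists_nbr
    have hms : m ∈ segment ℝ a b := he ▸ ⟨hmP, hmQ⟩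
    rw [he] at h2
    have h3 := nbr_of_isSide_segment h2
    rcases nbr_unique_of_mem hreg.convex hreg.interior_nonempty h hab hmo hms with
      ⟨rfl, rfl⟩ | ⟨rfl, rfl⟩
    · exact h3
    · exact h3.symm

lemma across_unique {P Q R : Set ℂ} {v x : ℂ} (hP : P ∈ T.tiles) (hQ : Q ∈ T.tiles)
    (hR : R ∈ T.tiles) (hQP : Q ≠ P) (hRP : R ≠ P) (nP : Nbr P v x) (nQ : Nbr Q v x)
    (nR : Nbr R v x) : Q = R := by
  by_contra hQR
  have hp := isRegularPolygon_sides hP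
  have hq := isRegularPolygon_sides hQ
  have hr := isRegularPolygon_sides hR
  have hs := fun P => corners_subset P
  rcases overlap_of_three hp.convex hq.convex hr.convex hp.interior_nonempty hq.interior_nonempty
    hr.interior_nonempty nP.2.2.1 (hs P nP.1) (hs P nP.2.1) (hs Q nQ.1) (hs Q nQ.2.1) (hs R nR.1)
    (hs R nR.2.1) with h | h | h
  · exact Set.not_disjoint_iff_nonempty_inter.2 h (T.nonoverlapping P hP Q hQ hQP.symm)
  · exact Set.not_disjoint_iff_nonempty_inter.2 h (T.nonoverlapping P hP R hR hRP.symm)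
  · exact Set.not_disjoint_iff_nonempty_inter.2 h (T.nonoverlapping Q hQ R hR hQR)

/-- A vertex, a side at this vertex given by its other end, and a tile with this side. -/
@[ext]
structure Flag (T : RegularPolygonTiling) where
  vert : ℂ
  other : ℂ
  tile : Set ℂ
  mem : tile ∈ T.tiles
  nbr : Nbr tile vert other

namespace Flag

lemma vert_mem (f : T.Flag) : f.vert ∈ f.tile := corners_subset _ f.nbr.1

lemma tile_mem_tilesAt (f : T.Flag) : f.tile ∈ T.tilesAt f.vert := ⟨f.mem, f.vert_mem⟩

/-- The flag with the other end of the side. -/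
def swapVert (f : T.Flag) : T.Flag := ⟨f.other, f.vert, f.tile, f.mem, f.nbr.symm⟩

lemma exists_swapSide (f : T.Flag) : ∃ y, y ≠ f.other ∧ Nbr f.tile f.vert y := by
  obtain ⟨a, b, hab, h⟩ := (isRegularPolygon_sides f.mem).exists_nbr_pair f.nbr.1
  rcases (h _).1 f.nbr with h1 | h1
  · exact ⟨b, by rw [h1]; exact hab.symm, (h b).2 (Or.inr rfl)⟩
  · exact ⟨a, by rw [h1]; exact hab, (h a).2 (Or.inl rfl)⟩

/-- The flag with the other side of the tile at the vertex. -/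
noncomputable def swapSide (f : T.Flag) : T.Flag :=
  ⟨f.vert, f.exists_swapSide.choose, f.tile, f.mem, f.exists_swapSide.choose_spec.2⟩

@[simp] lemma swapSide_tile (f : T.Flag) : f.swapSide.tile = f.tile := rfl

lemma swapSide_other_ne (f : T.Flag) : f.swapSide.other ≠ f.other :=
  f.exists_swapSide.choose_spec.1

lemma eq_or_eq_swapSide {f g : T.Flag} (hv : g.vert = f.vert) (ht : g.tile = f.tile) :
    g = f ∨ g = f.swapSide := by
  obtain ⟨a, b, hab, h⟩ := (isRegularPolygon_sides f.mem).exists_nbr_pair f.nbr.1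
  have h1 := (h _).1 f.nbr
  have h2 := (h _).1 f.swapSide.nbr
  have h3 := f.swapSide_other_ne
  have h4 : Nbr f.tile f.vert g.other := hv ▸ ht ▸ g.nbr
  have h5 := (h _).1 h4
  have : g.other = f.other ∨ g.other = f.swapSide.other := by grind
  rcases this with h6 | h6
  · exact Or.inl (Flag.ext hv h6 ht)
  · exact Or.inr (Flag.ext hv h6 ht)

lemma swapSide_ne (f : T.Flag) : f.swapSide ≠ f :=
  fun h => f.swapSide_other_ne (congrArg Flag.other h)

lemma swapSide_eq_of_ne {f g : T.Flag} (hv : g.vert = f.vert) (ht : g.tile = f.tile)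
    (hne : g ≠ f) : f.swapSide = g :=
  ((eq_or_eq_swapSide hv ht).resolve_left hne).symm

lemma swapSide_swapSide (f : T.Flag) : f.swapSide.swapSide = f :=
  swapSide_eq_of_ne rfl rfl f.swapSide_ne.symm

/-- The flag with the other tile at the side. -/
noncomputable def swapTile (hee : T.IsEdgeToEdge) (f : T.Flag) : T.Flag :=
  ⟨f.vert, f.other, (exists_across hee f.mem f.nbr).choose,
    (exists_across hee f.mem f.nbr).choose_spec.1, (exists_across hee f.mem f.nbr).choose_spec.2.2⟩

variable {hee : T.IsEdgeToEdge}

@[simp] lemma swapTile_vert (f : T.Flag) : (f.swapTile hee).vert = f.vert := rfl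

lemma swapTile_tile_ne (f : T.Flag) : (f.swapTile hee).tile ≠ f.tile :=
  (exists_across hee f.mem f.nbr).choose_spec.2.1

lemma swapTile_eq {f g : T.Flag} (hv : g.vert = f.vert) (ho : g.other = f.other)
    (ht : g.tile ≠ f.tile) : f.swapTile hee = g := by
  refine Flag.ext hv.symm ho.symm ?_
  have := f.swapTile_tile_ne (hee := hee)
  exact across_unique f.mem (f.swapTile hee).mem g.mem this ht f.nbr (f.swapTile hee).nbr
    (hv ▸ ho ▸ g.nbr)

lemma swapTile_swapTile (f : T.Flag) : (f.swapTile hee).swapTile hee = f :=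
  swapTile_eq rfl rfl f.swapTile_tile_ne.symm

/-- Otherwise one tile would share with `f.tile` the vertex and both corners next to it. -/
lemma swapTile_swapSide_tile_ne (f : T.Flag) :
    (f.swapSide.swapTile hee).tile ≠ (f.swapTile hee).tile := by
  intro h
  have h1 := (f.swapTile hee).nbr
  have h2 := (f.swapSide.swapTile hee).nbr
  rw [h] at h2
  have hs := corners_subset f.tile
  exact f.swapSide_other_ne (eq_of_common_corners hee (f.swapTile hee).mem f.mem f.swapTile_tile_ne
    h1.1 h1.2.1 h2.2.1 (hs f.nbr.1) (hs f.nbr.2.1) (hs f.swapSide.nbr.2.1) h1.2.2.1 h2.2.2.1).symm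

/-- Each step advances by one corner in the direction `ε` of the initial side. That the step does
not turn back uses that `n` does not divide 2. -/
lemma iterate_swapSide_swapVert (f : T.Flag) :
    (fun g : T.Flag => g.swapVert.swapSide)^[sides f.tile] f = f := by
  have hreg := isRegularPolygon_sides f.mem
  obtain ⟨p, hp, heq, hnbr⟩ := hreg.exists_cyclic
  have hv := f.nbr.1
  rw [hp] at hv
  obtain ⟨k, hk⟩ := hv
  have h1 := f.nbr
  rw [← hk, hnbr] at h1
  obtain ⟨ε, hε, h2⟩ : ∃ ε : ℤ, (ε = 1 ∨ ε = -1) ∧ f.other = p (k + ε) := by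
    rcases h1 with h1 | h1
    · exact ⟨1, Or.inl rfl, h1⟩
    · exact ⟨-1, Or.inr rfl, h1⟩
  have key : ∀ i : ℕ, ((fun g : T.Flag => g.swapVert.swapSide)^[i] f).vert = p (k + ε * i) ∧
      ((fun g : T.Flag => g.swapVert.swapSide)^[i] f).other = p (k + ε * (i + 1)) ∧
      ((fun g : T.Flag => g.swapVert.swapSide)^[i] f).tile = f.tile := by
    intro i
    induction i with
    | zero => simp [hk, h2]
    | succ i ih =>
      rw [Function.iterate_succ_apply']
      obtain ⟨i1, i2, i3⟩ := ih
      set g := (fun g : T.Flag => g.swapVert.swapSide)^[i] f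
      have hn : Nbr f.tile (p (k + ε * (i + 1))) (p (k + ε * (i + 1 + 1))) := by
        rw [hnbr]
        rcases hε with rfl | rfl
        · left; ring_nf
        · right; ring_nf
      have hg : g.swapVert.swapSide = ⟨_, _, f.tile, f.mem, hn⟩ := by
        refine swapSide_eq_of_ne i2.symm i3.symm fun h => ?_
        have h3 := congrArg Flag.other h
        change p (k + ε * (i + 1 + 1)) = g.vert at h3
        rw [i1, heq] at h3
        have h4 : (sides f.tile : ℤ) ∣ 2 := by
          rcases hε with rfl | rfl
          · ring_nf at h3; exact h3
          · ring_nf at h3; simpa using h3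
        have := Int.le_of_dvd (by norm_num) h4
        have := hreg.1
        lia
      rw [hg]
      push_cast
      exact ⟨rfl, rfl, rfl⟩
  obtain ⟨k1, k2, k3⟩ := key (sides f.tile)
  refine Flag.ext (k1.trans ?_) (k2.trans ?_) k3
  · rw [← hk, heq]; exact ⟨ε, by ring⟩
  · rw [h2, heq]; exact ⟨ε, by ring⟩

end Flag

/-- The flags of an edge-to-edge tiling. -/
noncomputable def flagSystem (hee : T.IsEdgeToEdge) : FlagSystem T.Flag where
  s0 := Flag.swapVert
  s1 := Flag.swapSide
  s2 := Flag.swapTile hee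
  size f := sides f.tile
  s0_s0 _ := rfl
  s1_s1 := Flag.swapSide_swapSide
  s2_s2 := Flag.swapTile_swapTile
  s0_s2 f := (Flag.swapTile_eq (f := f.swapVert) (g := (f.swapTile hee).swapVert) rfl rfl
    (f.swapTile_tile_ne (hee := hee))).symm
  size_s0 _ := rfl
  size_s1 _ := rfl
  three_le_size f := (isRegularPolygon_sides f.mem).1
  rotate_size := Flag.iterate_swapSide_swapVert

end RegularPolygonTiling

/-! ### The tiles around a vertex -/

namespace RegularPolygonTiling

open EuclideanTiling

variable {T : RegularPolygonTiling}

lemma exists_flag {P : Set ℂ} {v : ℂ} (hP : P ∈ T.tiles) (hv : v ∈ corners P) :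
    ∃ f : T.Flag, f.vert = v ∧ f.tile = P := by
  obtain ⟨a, b, -, h⟩ := (isRegularPolygon_sides hP).exists_nbr_pair hv
  exact ⟨⟨v, a, P, hP, (h a).2 (Or.inl rfl)⟩, rfl, rfl⟩

lemma corner_of_mem_tilesAt (hee : T.IsEdgeToEdge) (v : T.vertices) {P : Set ℂ}
    (hP : P ∈ T.tilesAt v) : (v : ℂ) ∈ corners P := by
  obtain ⟨v, Q, hQ, hv⟩ := v
  exact corner_of_mem hee hQ hP.1 hv hP.2

/-- The vertex of a flag. -/
def Flag.vertex (f : T.Flag) : T.vertices := ⟨f.vert, f.tile, f.mem, f.nbr.1⟩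

lemma image_neighborSet (v : T.vertices) :
    Subtype.val '' T.graph.neighborSet v = {x | ∃ P ∈ T.tiles, Nbr P v x} := by
  ext x
  constructor
  · rintro ⟨y, ⟨h1, P, hP, h2⟩, rfl⟩
    exact ⟨P, hP, nbr_of_isSide_segment h2⟩
  · rintro ⟨P, hP, h⟩
    exact ⟨⟨x, P, hP, h.2.1⟩, ⟨fun e => h.2.2.1 (congrArg Subtype.val e), P, hP, h.isSide⟩, rfl⟩

/-- There are as many tiles as edges at a vertex. -/
lemma ncard_tilesAt (hee : T.IsEdgeToEdge) (v : T.vertices) :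
    (T.tilesAt v).ncard = T.valence v := by
  classical
  rw [valence, ← Set.ncard_image_of_injective _ Subtype.val_injective, image_neighborSet]
  have hS := T.finite_tilesAt v
  have hpair : ∀ P ∈ T.tilesAt v, ∃ a b, a ≠ b ∧ ∀ x, Nbr P v x ↔ x = a ∨ x = b := fun P hP =>
    (isRegularPolygon_sides hP.1).exists_nbr_pair (corner_of_mem_tilesAt hee v hP)
  have hmem : ∀ {P x}, P ∈ T.tiles → Nbr P v x → P ∈ T.tilesAt v := fun hP h =>
    ⟨hP, corners_subset _ h.1⟩
  have hN : {x | ∃ P ∈ T.tiles, Nbr P v x}.Finite := by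
    have : {x | ∃ P ∈ T.tiles, Nbr P v x} = ⋃ P ∈ T.tilesAt v, {x | Nbr P v x} := by
      ext x
      simp only [Set.mem_iUnion]
      exact ⟨fun ⟨P, hP, h⟩ => ⟨P, hmem hP h, h⟩, fun ⟨P, hP, h⟩ => ⟨P, hP.1, h⟩⟩
    rw [this]
    refine hS.biUnion fun P hP => ?_
    obtain ⟨a, b, -, h⟩ := hpair P hP
    exact (Set.toFinite {a, b}).subset fun x hx => (h x).1 hx
  rw [Set.ncard_eq_toFinset_card _ hS, Set.ncard_eq_toFinset_card _ hN]
  -- Double counting: a tile at `v` has two sides at `v`, and a side at `v` lies in two tiles.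
  have := Finset.card_mul_eq_card_mul (s := hS.toFinset) (t := hN.toFinset) (m := 2) (n := 2)
    (fun P x => Nbr P v x) ?_ ?_
  · lia
  · intro P hP
    rw [Set.Finite.mem_toFinset] at hP
    obtain ⟨a, b, hab, h⟩ := hpair P hP
    rw [Finset.card_eq_two]
    refine ⟨a, b, hab, ?_⟩
    ext x
    simp only [Finset.mem_bipartiteAbove, Set.Finite.mem_toFinset, Finset.mem_insert,
      Finset.mem_singleton, h]
    exact ⟨fun h => h.2, fun hx => ⟨⟨P, hP.1, (h x).2 hx⟩, hx⟩⟩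
  · intro x hx
    rw [Set.Finite.mem_toFinset] at hx
    obtain ⟨P, hP, hPx⟩ := hx
    obtain ⟨Q, hQ, hQP, hQx⟩ := exists_across hee hP hPx
    rw [Finset.card_eq_two]
    refine ⟨P, Q, hQP.symm, ?_⟩
    ext R
    simp only [Finset.mem_bipartiteBelow, Set.Finite.mem_toFinset, Finset.mem_insert,
      Finset.mem_singleton]
    constructor
    · rintro ⟨hR, hRx⟩
      by_cases hRP : R = P
      · exact Or.inl hRP
      · exact Or.inr (across_unique hP hR.1 hQ hRP hQP hPx hRx hQx)
    · rintro (rfl | rfl)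
      · exact ⟨hmem hP hPx, hPx⟩
      · exact ⟨hmem hQ hQx, hQx⟩

/-- The angles at a vertex add up to a full turn. -/
lemma sum_inv_sides (hee : T.IsEdgeToEdge) (v : T.vertices) {S : Finset (Set ℂ)}
    (hS : (S : Set (Set ℂ)) = T.tilesAt v) :
    ∑ P ∈ S, (sides P : ℚ)⁻¹ = ((S.card : ℚ) - 2) / 2 := by
  have hmem : ∀ P ∈ S, P ∈ T.tilesAt v := fun P hP => hS ▸ hP
  have h := sum_angles (S := S) (v := (v : ℂ)) (α := fun P => Real.pi - 2 * Real.pi / sides P)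
    (fun P hP => (isRegularPolygon_sides (hmem P hP).1).exists_wedge
      (corner_of_mem_tilesAt hee v (hmem P hP)))
    (fun P hP Q hQ => T.nonoverlapping P (hmem P hP).1 Q (hmem Q hQ).1) ?_
  · simp only [Finset.sum_sub_distrib, Finset.sum_const, nsmul_eq_mul, div_eq_mul_inv,
      ← Finset.mul_sum] at h
    have hpi := Real.pi_pos.ne'
    have h2 : ∑ P ∈ S, (sides P : ℝ)⁻¹ = ((S.card : ℝ) - 2) / 2 := by
      apply mul_left_cancel₀ hpi
      linarith
    have h3 : ((∑ P ∈ S, (sides P : ℚ)⁻¹ : ℚ) : ℝ) = ((((S.card : ℚ) - 2) / 2 : ℚ) : ℝ) := by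
      push_cast
      exact h2
    exact_mod_cast h3
  · have := T.iUnion_tilesAt_mem_nhds v
    rw [← hS] at this
    simpa using this

variable {hee : T.IsEdgeToEdge}

/-- The tile of `f` and its two neighbours at the vertex are distinct, and by valence they are all
the tiles there. -/
lemma Flag.three (f : T.Flag) (hv : T.valence f.vertex = 3) : (T.flagSystem hee).Three f := by
  classical
  have h1 := f.swapTile_tile_ne (hee := hee)
  have h2 := f.swapSide.swapTile_tile_ne (hee := hee)
  have h3 := f.swapTile_swapSide_tile_ne (hee := hee)
  rw [swapSide_tile] at h2
  set S : Finset (Set ℂ) := {f.tile, (f.swapTile hee).tile, (f.swapSide.swapTile hee).tile} with hSd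
  have hcard : S.card = 3 := Finset.card_eq_three.2 ⟨_, _, _, h1.symm, h2.symm, h3.symm, rfl⟩
  have hS : (S : Set (Set ℂ)) = T.tilesAt f.vertex := by
    refine Set.eq_of_subset_of_ncard_le ?_ ?_ (T.finite_tilesAt _)
    · intro P hP
      rw [hSd] at hP
      simp only [Finset.coe_insert, Finset.coe_singleton, Set.mem_insert_iff,
        Set.mem_singleton_iff] at hP
      rcases hP with rfl | rfl | rfl
      · exact f.tile_mem_tilesAt
      · exact (f.swapTile hee).tile_mem_tilesAt
      · exact (f.swapSide.swapTile hee).tile_mem_tilesAt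
    · rw [ncard_tilesAt hee, hv, Set.ncard_coe_finset, hcard]
  have := sum_inv_sides hee f.vertex hS
  rw [hcard, hSd, Finset.sum_insert (by simp [h1.symm, h2.symm]),
    Finset.sum_insert (by simp [h3.symm]), Finset.sum_singleton] at this
  unfold FlagSystem.Three
  norm_num at this ⊢
  rw [← this, add_assoc]
  rfl

/-- The cyclic structure of the tiles around a `4`-valent vertex. -/
lemma Flag.four_aux (f : T.Flag) (hv : T.valence f.vertex = 4) :
    (f.swapTile hee).tile ≠ f.tile ∧ (f.swapSide.swapTile hee).tile ≠ f.tile ∧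
    (f.swapSide.swapTile hee).tile ≠ (f.swapTile hee).tile ∧
    ((f.swapTile hee).swapSide.swapTile hee).tile ≠ f.tile ∧
    ((f.swapTile hee).swapSide.swapTile hee).tile ≠ (f.swapTile hee).tile ∧
    ((f.swapTile hee).swapSide.swapTile hee).tile ≠ (f.swapSide.swapTile hee).tile := by
  have h1 := f.swapTile_tile_ne (hee := hee)
  have h2 := f.swapSide.swapTile_tile_ne (hee := hee)
  have h3 := f.swapTile_swapSide_tile_ne (hee := hee)
  have h4 := (f.swapTile hee).swapTile_swapSide_tile_ne (hee := hee)
  have h5 := (f.swapTile hee).swapSide.swapTile_tile_ne (hee := hee)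
  rw [swapSide_tile] at h2 h5
  rw [swapTile_swapTile] at h4
  refine ⟨h1, h2, h3, h4, h5, fun h => ?_⟩
  -- Suppose that the cycle closes up after three tiles. Valence 4 gives a further tile `R`.
  obtain ⟨R, hR, hR1, hR2, hR3⟩ : ∃ R ∈ T.tilesAt f.vertex, R ≠ f.tile ∧
      R ≠ (f.swapTile hee).tile ∧ R ≠ (f.swapSide.swapTile hee).tile := by
    by_contra! hcon
    have hsub : T.tilesAt f.vertex ⊆
        {f.tile, (f.swapTile hee).tile, (f.swapSide.swapTile hee).tile} := by
      intro R hR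
      have := hcon R hR
      simp only [Set.mem_insert_iff, Set.mem_singleton_iff]
      tauto
    have hle := Set.ncard_le_ncard hsub (Set.toFinite _)
    rw [ncard_tilesAt hee, hv] at hle
    have h6 := Set.ncard_insert_le f.tile {(f.swapTile hee).tile, (f.swapSide.swapTile hee).tile}
    have h7 := Set.ncard_insert_le (f.swapTile hee).tile {(f.swapSide.swapTile hee).tile}
    rw [Set.ncard_singleton] at h7
    lia
  -- The three tiles are closed under crossing sides at the vertex. Crossing a side of `R` hence
  -- cannot lead into them, as crossing back would too; it leads to a fifth tile.
  have hclosed : ∀ g : T.Flag, g.vert = f.vert → (g.tile = f.tile ∨ g.tile = (f.swapTile hee).tile ∨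
      g.tile = (f.swapSide.swapTile hee).tile) → ((g.swapTile hee).tile = f.tile ∨
      (g.swapTile hee).tile = (f.swapTile hee).tile ∨
      (g.swapTile hee).tile = (f.swapSide.swapTile hee).tile) := by
    rintro g hg (ht | ht | ht)
    · rcases eq_or_eq_swapSide hg ht with rfl | rfl
      · exact Or.inr (Or.inl rfl)
      · exact Or.inr (Or.inr rfl)
    · rcases eq_or_eq_swapSide (f := f.swapTile hee) hg ht with rfl | rfl
      · rw [swapTile_swapTile]; exact Or.inl rfl
      · exact Or.inr (Or.inr h)
    · rcases eq_or_eq_swapSide (f := f.swapSide.swapTile hee) hg ht with rfl | hg'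
      · rw [swapTile_swapTile]; exact Or.inl rfl
      · have hu := eq_or_eq_swapSide (f := f.swapSide.swapTile hee)
          (g := (f.swapTile hee).swapSide.swapTile hee) rfl h
        rcases hu with hu | hu
        · have := congrArg (Flag.swapTile hee) hu
          rw [swapTile_swapTile, swapTile_swapTile] at this
          exact absurd (congrArg Flag.tile this) h1
        · rw [hg', ← hu, swapTile_swapTile]; exact Or.inr (Or.inl rfl)
  obtain ⟨g, hgv, rfl⟩ := exists_flag hR.1 (corner_of_mem_tilesAt hee f.vertex hR)
  have hg := (g.swapTile hee).tile_mem_tilesAt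
  have hgne := g.swapTile_tile_ne (hee := hee)
  rw [swapTile_vert, hgv] at hg
  by_cases hin : (g.swapTile hee).tile = f.tile ∨ (g.swapTile hee).tile = (f.swapTile hee).tile ∨
      (g.swapTile hee).tile = (f.swapSide.swapTile hee).tile
  · have := hclosed (g.swapTile hee) hgv hin
    rw [swapTile_swapTile] at this
    tauto
  · simp only [not_or] at hin
    classical
    have hsub : (({f.tile, (f.swapTile hee).tile, (f.swapSide.swapTile hee).tile, g.tile,
        (g.swapTile hee).tile} : Finset (Set ℂ)) : Set (Set ℂ)) ⊆ T.tilesAt f.vert := by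
      intro P hP
      simp only [Finset.coe_insert, Finset.coe_singleton, Set.mem_insert_iff,
        Set.mem_singleton_iff] at hP
      rcases hP with rfl | rfl | rfl | rfl | rfl
      · exact f.tile_mem_tilesAt
      · exact (f.swapTile hee).tile_mem_tilesAt
      · exact (f.swapSide.swapTile hee).tile_mem_tilesAt
      · exact hR
      · exact hg
    have hle := Set.ncard_le_ncard hsub (T.finite_tilesAt _)
    rw [Set.ncard_coe_finset] at hle
    have hval := ncard_tilesAt hee f.vertex
    change (T.tilesAt f.vert).ncard = _ at hval
    rw [hval, hv] at hle
    rw [Finset.card_insert_of_notMem (by simp; tauto), Finset.card_insert_of_notMem (by simp; tauto),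
      Finset.card_insert_of_notMem (by simp; tauto), Finset.card_insert_of_notMem (by simp; tauto),
      Finset.card_singleton] at hle
    lia

lemma Flag.tilesAt_eq_four [DecidableEq (Set ℂ)] (f : T.Flag) (hv : T.valence f.vertex = 4) :
    (({f.tile, (f.swapTile hee).tile, ((f.swapTile hee).swapSide.swapTile hee).tile,
      (f.swapSide.swapTile hee).tile} : Finset (Set ℂ)) : Set (Set ℂ)) = T.tilesAt f.vertex ∧
    ({f.tile, (f.swapTile hee).tile, ((f.swapTile hee).swapSide.swapTile hee).tile,
      (f.swapSide.swapTile hee).tile} : Finset (Set ℂ)).card = 4 := by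
  obtain ⟨h1, h2, h3, h4, h5, h6⟩ := f.four_aux hv (hee := hee)
  have hcard : ({f.tile, (f.swapTile hee).tile, ((f.swapTile hee).swapSide.swapTile hee).tile,
      (f.swapSide.swapTile hee).tile} : Finset (Set ℂ)).card = 4 := by
    rw [Finset.card_insert_of_notMem (by simp; tauto), Finset.card_insert_of_notMem (by simp; tauto),
      Finset.card_insert_of_notMem (by simp; tauto), Finset.card_singleton]
  refine ⟨Set.eq_of_subset_of_ncard_le ?_ ?_ (T.finite_tilesAt _), hcard⟩
  · intro P hP
    simp only [Finset.coe_insert, Finset.coe_singleton, Set.mem_insert_iff,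
      Set.mem_singleton_iff] at hP
    rcases hP with rfl | rfl | rfl | rfl
    · exact f.tile_mem_tilesAt
    · exact (f.swapTile hee).tile_mem_tilesAt
    · exact ((f.swapTile hee).swapSide.swapTile hee).tile_mem_tilesAt
    · exact (f.swapSide.swapTile hee).tile_mem_tilesAt
  · rw [ncard_tilesAt hee, hv, Set.ncard_coe_finset, hcard]

/-- Both ways round the vertex reach the one remaining tile, and they reach it through different
sides, since these sides border different neighbours of `f.tile`. -/
lemma Flag.opposite_eq (f : T.Flag) (hv : T.valence f.vertex = 4) :
    ((f.swapTile hee).swapSide.swapTile hee).swapSide =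
      (f.swapSide.swapTile hee).swapSide.swapTile hee := by
  classical
  obtain ⟨h1, h2, h3, h4, h5, h6⟩ := f.four_aux hv (hee := hee)
  obtain ⟨k1, k2, k3, k4, k5, k6⟩ := f.swapSide.four_aux hv (hee := hee)
  rw [swapSide_swapSide] at k6
  have hw := ((f.swapSide.swapTile hee).swapSide.swapTile hee).tile_mem_tilesAt
  change _ ∈ T.tilesAt f.vertex at hw
  rw [← (f.tilesAt_eq_four hv (hee := hee)).1] at hw
  simp only [Finset.coe_insert, Finset.coe_singleton, Set.mem_insert_iff,
    Set.mem_singleton_iff] at hw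
  rw [swapSide_tile] at k4
  refine swapSide_eq_of_ne rfl (by tauto) fun h => ?_
  have := congrArg (Flag.swapTile hee) h
  rw [swapTile_swapTile, swapTile_swapTile] at this
  have ht := congrArg Flag.tile this
  exact h3 ht

lemma Flag.four (f : T.Flag) (hv : T.valence f.vertex = 4) : (T.flagSystem hee).Four f := by
  classical
  refine ⟨f.opposite_eq (hee := hee) hv, ?_⟩
  obtain ⟨h1, h2, h3, h4, h5, h6⟩ := f.four_aux hv (hee := hee)
  obtain ⟨hS, hcard⟩ := f.tilesAt_eq_four hv (hee := hee)
  have := sum_inv_sides hee f.vertex hS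
  rw [hcard, Finset.sum_insert (by simp; tauto), Finset.sum_insert (by simp; tauto),
    Finset.sum_insert (by simp; tauto), Finset.sum_singleton] at this
  norm_num at this ⊢
  rw [← this, ← add_assoc, ← add_assoc, add_right_comm]
  rfl

/-- The type of a `4`-valent vertex. -/
lemma Flag.hasVertexType (hee : T.IsEdgeToEdge) (f : T.Flag) (hv : T.valence f.vertex = 4) :
    T.HasVertexType f.vertex ![sides f.tile, sides (f.swapTile hee).tile,
      sides ((f.swapTile hee).swapSide.swapTile hee).tile,
      sides (f.swapSide.swapTile hee).tile] := by
  classical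
  obtain ⟨h1, h2, h3, h4, h5, h6⟩ := f.four_aux hv (hee := hee)
  obtain ⟨hS, hcard⟩ := f.tilesAt_eq_four hv (hee := hee)
  have side : ∀ g : T.Flag, g.vert = f.vert → ∃ e : Set ℂ, IsSide e g.tile ∧
      IsSide e (g.swapTile hee).tile ∧ f.vert ∈ e := fun g hg =>
    ⟨_, g.nbr.isSide, (g.swapTile hee).nbr.isSide, hg ▸ left_mem_segment _ _ _⟩
  refine ⟨![f.tile, (f.swapTile hee).tile, ((f.swapTile hee).swapSide.swapTile hee).tile,
      (f.swapSide.swapTile hee).tile], ?_, ?_, ?_, ?_⟩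
  · intro i j hij
    fin_cases i <;> fin_cases j <;> simp at hij ⊢ <;> tauto
  · change _ = T.tilesAt f.vertex
    rw [← hS]
    ext P
    simp [Matrix.range_cons]
    tauto
  · intro i
    fin_cases i
    · exact isRegularPolygon_sides f.mem
    · exact isRegularPolygon_sides (f.swapTile hee).mem
    · exact isRegularPolygon_sides ((f.swapTile hee).swapSide.swapTile hee).mem
    · exact isRegularPolygon_sides (f.swapSide.swapTile hee).mem
  · intro i
    fin_cases i
    · exact side f rfl
    · exact side (f.swapTile hee).swapSide rfl
    · have h := side ((f.swapTile hee).swapSide.swapTile hee).swapSide rfl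
      rw [swapSide_tile, f.opposite_eq hv, swapTile_swapTile] at h
      exact h
    · obtain ⟨e, e1, e2, e3⟩ := side f.swapSide rfl
      exact ⟨e, e2, e1, e3⟩

end RegularPolygonTiling

/-! ### Vertex types at valence 4 -/

namespace RegularPolygonTiling

open EuclideanTiling

variable {T : RegularPolygonTiling}

lemma HasVertexType.rotate {v : T.vertices} {a b c d : ℕ} (h : T.HasVertexType v ![a, b, c, d]) :
    T.HasVertexType v ![b, c, d, a] := by
  obtain ⟨p, hinj, hr, hreg, hs⟩ := h
  refine ⟨fun i => p (i + 1), hinj.comp (add_left_injective 1), ?_, ?_, fun i => hs (i + 1)⟩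
  · rw [← hr]
    exact (Equiv.addRight (1 : Fin 4)).surjective.range_comp p
  · intro i
    have := hreg (i + 1)
    fin_cases i <;> exact this

lemma HasVertexType.reverse {v : T.vertices} {a b c d : ℕ} (h : T.HasVertexType v ![a, b, c, d]) :
    T.HasVertexType v ![d, c, b, a] := by
  obtain ⟨p, hinj, hr, hreg, hs⟩ := h
  refine ⟨fun i => p (Fin.rev i), hinj.comp Fin.rev_injective, ?_, ?_, fun i => ?_⟩
  · rw [← hr]
    exact Fin.rev_surjective.range_comp p
  · intro i
    have := hreg (Fin.rev i)
    fin_cases i <;> exact this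
  · obtain ⟨e, e1, e2, e3⟩ := hs (Fin.rev (i + 1))
    refine ⟨e, ?_, e1, e3⟩
    convert e2 using 2
    fin_cases i <;> rfl

lemma exists_flag_of_tile {P : Set ℂ} (hP : P ∈ T.tiles) : ∃ f : T.Flag, f.tile = P := by
  have h := isRegularPolygon_sides hP
  have hne : (corners P).Nonempty := by
    apply Set.nonempty_of_ncard_ne_zero
    have : sides P = (corners P).ncard := rfl
    have := h.1
    lia
  obtain ⟨v, hv⟩ := hne
  obtain ⟨f, -, hf⟩ := exists_flag hP hv
  exact ⟨f, hf⟩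

lemma exists_flag_of_vertex (v : T.vertices) : ∃ f : T.Flag, f.vertex = v := by
  obtain ⟨v, P, hP, hv⟩ := v
  obtain ⟨f, hf, -⟩ := exists_flag hP hv
  exact ⟨f, Subtype.ext hf⟩

lemma sides_mem_of_four (hee : T.IsEdgeToEdge) (h4 : ∀ v : T.vertices, T.valence v = 4)
    {P : Set ℂ} (hP : P ∈ T.tiles) : sides P = 3 ∨ sides P = 4 ∨ sides P = 6 := by
  obtain ⟨f, rfl⟩ := exists_flag_of_tile hP
  exact FlagSystem.size_mem_of_four (S := T.flagSystem hee) (fun f => f.four (h4 _)) f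

lemma sides_mem (hee : T.IsEdgeToEdge) (hval : ∀ v : T.vertices, T.valence v = 3 ∨ T.valence v = 4)
    {P : Set ℂ} (hP : P ∈ T.tiles) : sides P ∈ ({3, 4, 6, 8, 12} : Set ℕ) := by
  obtain ⟨f, rfl⟩ := exists_flag_of_tile hP
  exact FlagSystem.size_mem_of_three_or_four (S := T.flagSystem hee)
    (fun f => (hval f.vertex).imp f.three f.four) f

/-- The possible types of the vertices if all of them are `4`-valent. -/
lemma vertexType_of_four (hee : T.IsEdgeToEdge) (h4 : ∀ v : T.vertices, T.valence v = 4)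
    (v : T.vertices) :
    T.HasVertexType v ![3, 3, 6, 6] ∨ T.HasVertexType v ![3, 6, 3, 6] ∨
    T.HasVertexType v ![3, 4, 4, 6] ∨ T.HasVertexType v ![3, 4, 6, 4] ∨
    T.HasVertexType v ![4, 4, 4, 4] := by
  obtain ⟨f, rfl⟩ := exists_flag_of_vertex v
  have h := f.hasVertexType hee (h4 _)
  have hsum := (f.four (hee := hee) (h4 _)).2
  change (sides f.tile : ℚ)⁻¹ + (sides (f.swapTile hee).tile : ℚ)⁻¹ +
    (sides (f.swapSide.swapTile hee).tile : ℚ)⁻¹ +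
    (sides ((f.swapTile hee).swapSide.swapTile hee).tile : ℚ)⁻¹ = 1 at hsum
  have m1 := sides_mem_of_four hee h4 f.mem
  have m2 := sides_mem_of_four hee h4 (f.swapTile hee).mem
  have m3 := sides_mem_of_four hee h4 ((f.swapTile hee).swapSide.swapTile hee).mem
  have m4 := sides_mem_of_four hee h4 (f.swapSide.swapTile hee).mem
  generalize sides f.tile = a at *
  generalize sides (f.swapTile hee).tile = b at *
  generalize sides ((f.swapTile hee).swapSide.swapTile hee).tile = c at *
  generalize sides (f.swapSide.swapTile hee).tile = d at *
  -- Of the 81 cyclic words in 3, 4, 6, the angle equation keeps those that are rotations or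
  -- reversals of the five types.
  rcases m1 with rfl | rfl | rfl <;> rcases m2 with rfl | rfl | rfl <;>
    rcases m3 with rfl | rfl | rfl <;> rcases m4 with rfl | rfl | rfl <;>
    first
    | (exfalso; norm_num at hsum; done)
    | (have r1 := h.rotate
       have r2 := r1.rotate
       have r3 := r2.rotate
       have s0 := h.reverse
       have s1 := r1.reverse
       have s2 := r2.reverse
       have s3 := r3.reverse
       first
       | (left; assumption)
       | (right; left; assumption)
       | (right; right; left; assumption)
       | (right; right; right; left; assumption)
       | (right; right; right; right; assumption))

end RegularPolygonTiling

/-! ### Counting orbits under the lattice -/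

/-- For an equivariant map to a free action, an orbit upstairs is an orbit downstairs with a point
of the fibre over a representative. -/
noncomputable def AddAction.orbitEquivSigma {G A B : Type*} [AddGroup G] [AddAction G A]
    [AddAction G B] (f : A → B) (hf : ∀ (g : G) a, f (g +ᵥ a) = g +ᵥ f a)
    (hfree : ∀ (g : G) (b : B), g +ᵥ b = b → g = 0) :
    (Σ o : AddAction.orbitRel.Quotient G B, {a // f a = o.out}) ≃
      AddAction.orbitRel.Quotient G A := by
  refine Equiv.ofBijective (fun x => Quotient.mk _ x.2.1) ⟨?_, ?_⟩
  · rintro ⟨o, a, ha⟩ ⟨o', a', ha'⟩ h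
    obtain ⟨g, hg⟩ := AddAction.orbitRel_apply.1 (Quotient.exact h)
    simp only at hg
    -- Equivariance makes the two representatives downstairs equivalent, hence equal, and then
    -- freeness gives `g = 0`.
    have h1 : o.out = g +ᵥ o'.out := by rw [← ha, ← ha', ← hg, hf]
    have h2 : o = o' := by
      rw [← Quotient.out_eq o, ← Quotient.out_eq o']
      exact Quotient.sound (AddAction.orbitRel_apply.2 ⟨g, h1.symm⟩)
    subst h2
    obtain rfl := hfree g _ h1.symm
    rw [zero_vadd] at hg
    subst hg
    rfl
  · intro q
    obtain ⟨a, rfl⟩ := Quotient.exists_rep q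
    obtain ⟨g, hg⟩ := AddAction.orbitRel_apply.1
      (Quotient.exact (Quotient.out_eq (Quotient.mk (AddAction.orbitRel G B) (f a))))
    refine ⟨⟨Quotient.mk _ (f a), g +ᵥ a, by rw [hf]; exact hg⟩, ?_⟩
    exact Quotient.sound (AddAction.orbitRel_apply.2 ⟨g, rfl⟩)

namespace EuclideanTiling

lemma translateBy_zero (P : Set ℂ) : translateBy 0 P = P := by simp [translateBy]

lemma translateBy_add (s t : ℂ) (P : Set ℂ) :
    translateBy (s + t) P = translateBy s (translateBy t P) := by
  simp only [translateBy, Set.image_image, add_assoc]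

lemma corners_translateBy (t : ℂ) (P : Set ℂ) :
    corners (translateBy t P) = translateBy t (corners P) := by
  have key : ∀ (t : ℂ) (P : Set ℂ), translateBy t (corners P) ⊆ corners (translateBy t P) := by
    rintro t P _ ⟨v, hv, rfl⟩
    refine mem_extremePoints_iff_left.2 ⟨⟨v, corners_subset P hv, rfl⟩, ?_⟩
    rintro _ ⟨x, hx, rfl⟩ _ ⟨y, hy, rfl⟩ h
    have := (mem_extremePoints_iff_left.1 hv).2 x hx y hy ((mem_openSegment_translate ℝ t).1 h)
    simp [this]
  refine Set.Subset.antisymm ?_ (key t P)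
  -- The reverse inclusion is the first one for `-t`, translated back.
  have h := Set.image_mono (f := fun z => t + z) (key (-t) (translateBy t P))
  change translateBy t (translateBy (-t) _) ⊆ translateBy t (corners _) at h
  rwa [← translateBy_add, ← translateBy_add, add_neg_cancel, neg_add_cancel, translateBy_zero,
    translateBy_zero] at h

/-- The inner product with `t` attains a maximum on `P`, and translating by `t` raises it by `‖t‖²`.
This makes the action on tiles free. -/
lemma eq_zero_of_translateBy_eq {P : Set ℂ} (hP : IsCompact P) (hne : P.Nonempty) {t : ℂ}
    (h : translateBy t P = P) : t = 0 := by
  obtain ⟨z, hz, hmax⟩ := hP.exists_isMaxOn hne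
    (f := fun z : ℂ => t.re * z.re + t.im * z.im) (by fun_prop)
  have h1 : t + z ∈ P := h ▸ ⟨z, hz, rfl⟩
  have h2 : t.re * (t + z).re + t.im * (t + z).im ≤ t.re * z.re + t.im * z.im := hmax h1
  simp only [Complex.add_re, Complex.add_im] at h2
  have h3 : t.re * t.re + t.im * t.im = 0 :=
    le_antisymm (by linarith) (add_nonneg (mul_self_nonneg _) (mul_self_nonneg _))
  apply Complex.normSq_eq_zero.1
  rw [Complex.normSq_apply, h3]

/-- The translates of some compact set under a lattice of full rank cover the plane. -/
lemma exists_isCompact_translate (Λ : Submodule ℤ ℂ) [DiscreteTopology Λ] [IsZLattice ℝ Λ] :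
    ∃ K : Set ℂ, IsCompact K ∧ ∀ z, ∃ t ∈ Λ, t + z ∈ K := by
  set b := (Module.Free.chooseBasis ℤ Λ).ofZLatticeBasis ℝ Λ
  refine ⟨closure (ZSpan.fundamentalDomain b), (ZSpan.fundamentalDomain_isBounded b).isCompact_closure,
    fun z => ⟨-(ZSpan.floor b z : ℂ), ?_, subset_closure ?_⟩⟩
  · rw [neg_mem_iff]
    exact (Module.Basis.ofZLatticeBasis_span ℝ Λ (Module.Free.chooseBasis ℤ Λ)).le
      (ZSpan.floor b z).2
  · have := ZSpan.fract_mem_fundamentalDomain b z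
    rwa [ZSpan.fract_apply, sub_eq_neg_add] at this

end EuclideanTiling

namespace RegularPolygonTiling

open EuclideanTiling

variable {T : RegularPolygonTiling}

lemma sides_translateBy (t : ℂ) (P : Set ℂ) : sides (translateBy t P) = sides P := by
  rw [sides, corners_translateBy, translateBy,
    Set.ncard_image_of_injective _ (add_right_injective t), sides]

/-- The tiles with `n` sides. -/
abbrev Gon (T : RegularPolygonTiling) (n : ℕ) := {P : Set ℂ // P ∈ T.tiles ∧ sides P = n}

/-- The pairs of a tile with `n` sides and a corner of it. -/
abbrev GonCorner (T : RegularPolygonTiling) (n : ℕ) :=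
  {x : ℂ × Set ℂ // (x.2 ∈ T.tiles ∧ sides x.2 = n) ∧ x.1 ∈ corners x.2}

/-- The tile of a corner. -/
def GonCorner.gon {n : ℕ} (x : T.GonCorner n) : T.Gon n := ⟨x.1.2, x.2.1⟩

/-- The corner as a vertex of the tiling. -/
def GonCorner.vertex {n : ℕ} (x : T.GonCorner n) : T.vertices :=
  ⟨x.1.1, x.1.2, x.2.1.1, x.2.2⟩

/-- The translations on the tiles with `n` sides. -/
@[reducible] def gonAction {Λ : Submodule ℤ ℂ} (hΛ : T.IsPeriodLattice Λ) (n : ℕ) :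
    AddAction Λ (T.Gon n) where
  vadd t P := ⟨translateBy t P.1, hΛ.translate_mem t t.2 P.1 P.2.1, by
    rw [sides_translateBy, P.2.2]⟩
  zero_vadd _ := Subtype.ext (translateBy_zero _)
  add_vadd _ _ _ := Subtype.ext (translateBy_add _ _ _)

/-- The translations on the corners of the tiles with `n` sides. -/
@[reducible] def gonCornerAction {Λ : Submodule ℤ ℂ} (hΛ : T.IsPeriodLattice Λ) (n : ℕ) :
    AddAction Λ (T.GonCorner n) where
  vadd t x := ⟨(t + x.1.1, translateBy t x.1.2), ⟨hΛ.translate_mem t t.2 x.1.2 x.2.1.1, by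
    rw [sides_translateBy, x.2.1.2]⟩, by
    rw [corners_translateBy]; exact ⟨x.1.1, x.2.2, rfl⟩⟩
  zero_vadd _ := Subtype.ext (Prod.ext (zero_add _) (translateBy_zero _))
  add_vadd _ _ _ := Subtype.ext (Prod.ext (add_assoc _ _ _) (translateBy_add _ _ _))

/-- The translations on the vertices. -/
@[reducible] def vertexAction {Λ : Submodule ℤ ℂ} (hΛ : T.IsPeriodLattice Λ) :
    AddAction Λ T.vertices where
  vadd t v := ⟨t + v, by
    obtain ⟨P, hP, hv⟩ := v.2
    exact ⟨translateBy t P, hΛ.translate_mem t t.2 P hP, by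
      rw [corners_translateBy]; exact ⟨v, hv, rfl⟩⟩⟩
  zero_vadd _ := Subtype.ext (zero_add _)
  add_vadd _ _ _ := Subtype.ext (add_assoc _ _ _)

/-- The orbits of corners of `n`-gons are `n` times as many as the orbits of `n`-gons. -/
lemma card_gonCorner_orbits {Λ : Submodule ℤ ℂ} (hΛ : T.IsPeriodLattice Λ) {n : ℕ} (hn : n ≠ 0) :
    letI := gonAction hΛ n
    letI := gonCornerAction hΛ n
    Nat.card (AddAction.orbitRel.Quotient Λ (T.GonCorner n)) =
      Nat.card (AddAction.orbitRel.Quotient Λ (T.Gon n)) * n := by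
  let := gonAction hΛ n
  let := gonCornerAction hΛ n
  have e := AddAction.orbitEquivSigma (G := Λ) (GonCorner.gon (T := T) (n := n))
    (fun _ _ => rfl) ?_
  · have fib : ∀ P : T.Gon n,
        Nonempty ({x : T.GonCorner n // x.gon = P} ≃ Fin n) := by
      intro P
      have e1 : {x : T.GonCorner n // x.gon = P} ≃ corners P.1 :=
        { toFun := fun x => ⟨x.1.1.1, (congrArg Subtype.val x.2 : x.1.1.2 = P.1) ▸ x.1.2.2⟩
          invFun := fun v => ⟨⟨(v, P.1), P.2, v.2⟩, rfl⟩
          left_inv := by rintro ⟨⟨⟨v, Q⟩, hQ⟩, rfl⟩; rfl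
          right_inv := fun _ => rfl }
      have hc : Nat.card (corners P.1) = n := P.2.2
      have : Finite (corners P.1) := Nat.finite_of_card_ne_zero (by rw [hc]; exact hn)
      exact ⟨e1.trans (Finite.equivFinOfCardEq hc)⟩
    have e2 := e.symm.trans ((Equiv.sigmaCongrRight fun o => (fib (Quotient.out o)).some).trans
      (Equiv.sigmaEquivProd _ _))
    rw [Nat.card_congr e2, Nat.card_prod, Nat.card_fin]
  · intro t P h
    have hreg := isRegularPolygon_sides P.2.1
    have h1 := hreg.interior_nonempty.mono interior_subset
    exact Subtype.ext (eq_zero_of_translateBy_eq hreg.isCompact h1 (congrArg Subtype.val h))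

/-- At each vertex there are as many triangles as hexagons. -/
lemma card_three_eq_card_six (hee : T.IsEdgeToEdge) (h4 : ∀ v : T.vertices, T.valence v = 4)
    (v : T.vertices) :
    {P | P ∈ T.tilesAt v ∧ sides P = 3}.ncard = {P | P ∈ T.tilesAt v ∧ sides P = 6}.ncard := by
  classical
  have hfin := T.finite_tilesAt v
  have hsum := sum_inv_sides hee v (S := hfin.toFinset) (by simp)
  have hcard : hfin.toFinset.card = 4 := by
    rw [← Set.ncard_eq_toFinset_card _ hfin, ncard_tilesAt hee, h4]
  -- Four terms `1/4` already give the sum 1, so the deviations `1/12` of triangles and `-1/12` of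
  -- hexagons cancel.
  have hterm : ∀ P ∈ hfin.toFinset, (sides P : ℚ)⁻¹ =
      1 / 4 + (1 / 12) * (if sides P = 3 then 1 else 0) -
        (1 / 12) * (if sides P = 6 then 1 else 0) := by
    intro P hP
    rcases sides_mem_of_four hee h4 ((Set.Finite.mem_toFinset hfin).1 hP).1 with h | h | h <;>
      rw [h] <;> norm_num
  rw [Finset.sum_congr rfl hterm, Finset.sum_sub_distrib, Finset.sum_add_distrib,
    ← Finset.mul_sum, ← Finset.mul_sum, Finset.sum_const, hcard, Finset.sum_boole,
    Finset.sum_boole] at hsum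
  have key : ∀ n, {P | P ∈ T.tilesAt v ∧ sides P = n}.ncard =
      (hfin.toFinset.filter fun P => sides P = n).card := by
    intro n
    rw [← Set.ncard_coe_finset]
    congr 1
    ext P
    simp
  rw [key, key]
  norm_num at hsum
  have : ((hfin.toFinset.filter fun P => sides P = 3).card : ℚ) =
      (hfin.toFinset.filter fun P => sides P = 6).card := by linarith
  exact_mod_cast this

/-- The corners of triangles and the corners of hexagons have equally many orbits. -/
lemma card_gonCorner_three_eq_six (hee : T.IsEdgeToEdge)
    (h4 : ∀ v : T.vertices, T.valence v = 4) {Λ : Submodule ℤ ℂ} (hΛ : T.IsPeriodLattice Λ) :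
    letI := gonCornerAction hΛ 3
    letI := gonCornerAction hΛ 6
    Nat.card (AddAction.orbitRel.Quotient Λ (T.GonCorner 3)) =
      Nat.card (AddAction.orbitRel.Quotient Λ (T.GonCorner 6)) := by
  let := gonCornerAction hΛ 3
  let := gonCornerAction hΛ 6
  let := vertexAction hΛ
  have hfree : ∀ (t : Λ) (v : T.vertices), t +ᵥ v = v → t = 0 := by
    intro t v h
    have h1 : (t : ℂ) + v = v := congrArg Subtype.val h
    exact Subtype.ext (by simpa using h1)
  have e : ∀ n (v : T.vertices), Nonempty ({x : T.GonCorner n //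
      x.vertex = v} ≃
      {P | P ∈ T.tilesAt v ∧ sides P = n}) := by
    intro n v
    exact ⟨{
      toFun := fun x => ⟨x.1.1.2, ⟨x.1.2.1.1,
        (congrArg Subtype.val x.2 : x.1.1.1 = v) ▸ corners_subset _ x.1.2.2⟩,
        x.1.2.1.2⟩
      invFun := fun P => ⟨⟨(v, P.1), ⟨P.2.1.1, P.2.2⟩, corner_of_mem_tilesAt hee v P.2.1⟩, rfl⟩
      left_inv := by rintro ⟨⟨⟨v, Q⟩, hQ⟩, rfl⟩; rfl
      right_inv := fun _ => rfl }⟩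
  have hfin : ∀ n (v : T.vertices), Finite {P | P ∈ T.tilesAt v ∧ sides P = n} := fun n v =>
    ((T.finite_tilesAt v).subset fun P hP => hP.1).to_subtype
  -- Both kinds of corners are equally many over each vertex; such bijections over the orbit
  -- representatives give one between the orbits.
  have fib : ∀ v : T.vertices, {x : T.GonCorner 3 //
      x.vertex = v} ≃ {x : T.GonCorner 6 //
      x.vertex = v} := by
    intro v
    have := hfin 3 v
    have := hfin 6 v
    exact (e 3 v).some.trans (((Finite.equivFinOfCardEq (card_three_eq_card_six hee h4 v)).trans
      (Finite.equivFin _).symm).trans (e 6 v).some.symm)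
  have e3 := AddAction.orbitEquivSigma (G := Λ)
    (GonCorner.vertex (T := T) (n := 3)) (fun _ _ => rfl) hfree
  have e6 := AddAction.orbitEquivSigma (G := Λ)
    (GonCorner.vertex (T := T) (n := 6)) (fun _ _ => rfl) hfree
  exact Nat.card_congr (e3.symm.trans ((Equiv.sigmaCongrRight fun o => fib (Quotient.out o)).trans e6))

/-- The orbits of tiles with `n` sides, as subsets and as a quotient. -/
lemma ncard_polygonOrbits {Λ : Submodule ℤ ℂ} (hΛ : T.IsPeriodLattice Λ) (n : ℕ) :
    letI := gonAction hΛ n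
    (T.polygonOrbits Λ n).ncard = Nat.card (AddAction.orbitRel.Quotient Λ (T.Gon n)) := by
  let := gonAction hΛ n
  set φ : T.Gon n → Set (Set ℂ) := fun P => {Q | ∃ t ∈ Λ, Q = translateBy t P.1} with hφ
  have hrange : T.polygonOrbits Λ n = Set.range φ := by
    ext O
    constructor
    · rintro ⟨P, hP, hn, rfl⟩
      exact ⟨⟨P, hP, (isRegularPolygon_iff hP).1 hn⟩, rfl⟩
    · rintro ⟨P, rfl⟩
      exact ⟨P.1, P.2.1, (isRegularPolygon_iff P.2.1).2 P.2.2, rfl⟩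
  have hker : AddAction.orbitRel Λ (T.Gon n) = Setoid.ker φ := by
    ext P Q
    rw [AddAction.orbitRel_apply, Setoid.ker_def]
    constructor
    · rintro ⟨t, rfl⟩
      ext R
      constructor
      · rintro ⟨s, hs, rfl⟩
        exact ⟨s + t, add_mem hs t.2, (translateBy_add _ _ _).symm⟩
      · rintro ⟨s, hs, rfl⟩
        refine ⟨s - t, sub_mem hs t.2, ?_⟩
        change _ = translateBy (s - t) (translateBy t Q.1)
        rw [← translateBy_add, sub_add_cancel]
    · intro h
      have : P.1 ∈ φ Q := h ▸ ⟨0, zero_mem _, (translateBy_zero _).symm⟩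
      obtain ⟨t, ht, e⟩ := this
      exact ⟨⟨t, ht⟩, Subtype.ext e.symm⟩
  rw [hrange, ← Nat.card_coe_set_eq, AddAction.orbitRel.Quotient, hker]
  exact Nat.card_congr (Setoid.quotientKerEquivRange φ).symm

/-- Every orbit has a tile that meets a fixed compact set, and by local finiteness only finitely
many tiles do. -/
lemma finite_polygonOrbits {Λ : Submodule ℤ ℂ} (hΛ : T.IsPeriodLattice Λ) (n : ℕ) :
    (T.polygonOrbits Λ n).Finite := by
  have := hΛ.discrete
  have := hΛ.isZLattice
  obtain ⟨K, hK, hcov⟩ := exists_isCompact_translate Λ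
  have hfin := (T.locallyFinite.finite_nonempty_inter_compact hK).image
    fun P : T.tiles => {Q | ∃ t ∈ Λ, Q = translateBy t P.1}
  refine hfin.subset ?_
  rintro _ ⟨P, hP, hn, rfl⟩
  obtain ⟨z, hz⟩ := hn.interior_nonempty.mono interior_subset
  obtain ⟨t, ht, htz⟩ := hcov z
  refine ⟨⟨translateBy t P, hΛ.translate_mem t ht P hP⟩, ⟨t + z, ⟨z, hz, rfl⟩, htz⟩, ?_⟩
  ext Q
  constructor
  · rintro ⟨s, hs, rfl⟩
    exact ⟨s + t, add_mem hs ht, (translateBy_add _ _ _).symm⟩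
  · rintro ⟨s, hs, rfl⟩
    exact ⟨s - t, sub_mem hs ht, by rw [← translateBy_add, sub_add_cancel]⟩

end RegularPolygonTiling

theorem lemma3p1 (T : RegularPolygonTiling) (hee : T.IsEdgeToEdge) (hper : T.IsBiperiodic)
    (hval : ∀ v : T.vertices, T.valence v = 3 ∨ T.valence v = 4) (hmatch : T.HasMatching) :
    ((∀ v : T.vertices, T.valence v = 4) →
      (∀ P ∈ T.tiles, ∃ n ∈ ({3, 4, 6} : Set ℕ), EuclideanTiling.IsRegularPolygon n P) ∧
      (∀ v : T.vertices,
        T.HasVertexType v ![3, 3, 6, 6] ∨ T.HasVertexType v ![3, 6, 3, 6] ∨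
        T.HasVertexType v ![3, 4, 4, 6] ∨ T.HasVertexType v ![3, 4, 6, 4] ∨
        T.HasVertexType v ![4, 4, 4, 4])) ∧
    ((∀ v : T.vertices, T.valence v = 4) →
      ∀ Λ : Submodule ℤ ℂ, T.IsPeriodLattice Λ →
        (T.polygonOrbits Λ 3).Finite ∧ (T.polygonOrbits Λ 6).Finite ∧
        (T.polygonOrbits Λ 3).ncard = 2 * (T.polygonOrbits Λ 6).ncard) ∧
    ((∃ v : T.vertices, T.valence v = 3) →
      ∀ P ∈ T.tiles, ∃ n ∈ ({3, 4, 6, 8, 12} : Set ℕ), EuclideanTiling.IsRegularPolygon n P) := by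
  open RegularPolygonTiling in
  refine ⟨fun h4 => ⟨fun P hP => ⟨sides P, ?_, isRegularPolygon_sides hP⟩,
    vertexType_of_four hee h4⟩, fun h4 Λ hΛ => ⟨finite_polygonOrbits hΛ 3,
    finite_polygonOrbits hΛ 6, ?_⟩, fun _ P hP => ⟨sides P, sides_mem hee hval hP,
    isRegularPolygon_sides hP⟩⟩
  · rcases sides_mem_of_four hee h4 hP with h | h | h <;> simp [h]
  -- Orbits of corners: three per orbit of triangles, six per orbit of hexagons, and equally many of
  -- both kinds.
  · have h3 := card_gonCorner_orbits hΛ (n := 3) (by norm_num)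
    have h6 := card_gonCorner_orbits hΛ (n := 6) (by norm_num)
    have h36 := card_gonCorner_three_eq_six hee h4 hΛ
    have e3 := ncard_polygonOrbits hΛ 3
    have e6 := ncard_polygonOrbits hΛ 6
    lia
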